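/- Let $\Bbbk$ be a field in which $2\neq 0$, let $n\ge 2$ and $1\le i\le n-1$. **The category $\mathcal C$.** Its objects are $T_0,\dots,T_n$. The space $\mathrm{Hom}(T_j,T_l)=\bigoplus_{\alpha\ge 0}\Bbbk\,a_{lj}s^\alpha$ is concentrated in degree $0$, the only nonzero $A_\infty$-operation is $$\mu^2(a_{lm}s^\beta,a_{mj}s^\alpha)=a_{lj}s^{\alpha+\beta+\delta(j,m,l)},\qquad \delta(j,m,l)=\begin{cases}0,&(j-m)(m-l)\ge 0,\\ \min(|j-m|,|m-l|),&\text{otherwise,}\end{cases}$$ and $\mathfrak q(a_{lj}s^\alpha)=2\alpha+|l-j|$ is the $\mathfrak q$-grading. The morphism $a_{jj}s^\alpha$ is also written $s^\alpha$. Let $\mathrm{Tw}^b(\mathcal C)$ be the $A_\infty$-category of bounded twisted complexes over $\mathcal C$. Its morphisms of degree $p$ are matrices $f$ of morphisms of $\mathcal C$ between components whose cohomological degrees differ by $p$; if $\delta_Y$, $\delta_Z$ are the differentials of $Y$, $Z$, then $\mu^1_\delta(f)=(-1)^{|f|}\delta_Z f-f\delta_Y$ for $f:Y\to Z$ and $\mu^2_\delta(g,f)=(-1)^{|f|}gf$,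 and the other operations vanish. **The functors.** Let $\mathrm{id}:\mathcal C\to\mathrm{Tw}^b(\mathcal C)$ be the inclusion. Let $\beta=\beta_{i}^-:\mathcal C\to\mathrm{Tw}^b(\mathcal C)$ be the $A_\infty$-functor with $\beta T_j=T_j$ for $j\ne i$ and $$\beta T_i=\bigl(T_i\xrightarrow{[\,a_{i-1,i},\,-a_{i+1,i}]}T_{i-1}\oplus T_{i+1}\bigr),$$ where $T_i$ is in degree $-1$ and $T_{i-1}\oplus T_{i+1}$ in degree $0$, and with the following components. * $\beta^1(a_{lj}s^\alpha)$ is: $a_{lj}s^\alpha$ for $j,l\neq i$; the map $a_{i+1,j}s^\alpha$ into $T_{i+1}$ for $l=i<j$; the map $a_{i-1,j}s^\alpha$ into $T_{i-1}$ for $j<i=l$; the map $[a_{l,i-1}s^\alpha,\ a_{l,i+1}s^{\alpha+1}]$ out of $T_{i-1}\oplus T_{i+1}$ for $j=i<l$; the map $[a_{l,i-1}s^{\alpha+1},\ a_{l,i+1}s^{\alpha}]$ out of $T_{i-1}\oplus T_{i+1}$ for $l<i=j$; and $s^\alpha$ on each of the three components for $j=l=i$. * $\beta^2(a_{lm}s^\beta,a_{mj}s^\alpha)$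 vanishes for $l\ne i$. For $l=i$ it takes values in the component $T_i$ of $\beta T_i$: for $j\neq i$ it is $\mathrm{sgn}(i-m)\,a_{ij}s^{\alpha+\beta+|i-m|-1}$ if $m<i<j$ or $j<i<m$, and $0$ otherwise; for $j=i$ it is $a_{i,i+1}s^{\alpha+\beta+|i-m|-1}$ on the component $T_{i+1}$ of the source $\beta T_i$ if $m<i$, it is $-a_{i,i-1}s^{\alpha+\beta+|i-m|-1}$ on the component $T_{i-1}$ if $m>i$, and $0$ if $m=i$. * $\beta^d=0$ for $d\ge 3$. **Natural transformations.** A pre-natural transformation $\eta:\mathrm{id}\Rightarrow\beta$ of degree $g$ is a family $(\eta^d)_{d\ge0}$ of multilinear maps $\eta^d:\mathrm{Hom}(X_{d-1},X_d)\otimes\cdots\otimes\mathrm{Hom}(X_0,X_1)\to\mathrm{Hom}(X_0,\beta X_d)[g-d]$. Its differential is $$(\mu^1\eta)^d(a_d,\dots,a_1)=\mu^1_\delta(\eta^d(a_d,\dots,a_1))+\sum_{p}\mu^2_\delta\bigl(\beta^{d-p}(a_d,\dots,a_{p+1}),\eta^p(a_p,\dots,a_1)\bigr)+(-1)^{g-1}\mu^2_\delta\bigl(\eta^{d-1}(a_d,\dots,a_2),a_1\bigr)-\sum_t(-1)^{t+g-1}\eta^{d-1}(a_d,\dots,\mu^2(a_{t+2},a_{t+1}),\dots,a_1).$$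 The natural transformations of degree $g$ are those with $\mu^1\eta=0$, and $\mathrm{HH}^g(\mathfrak B_{i^-})=H^g\mathrm{Hom}(\mathrm{id},\beta)$ is the cohomology of this complex. **Theorem.** For every finitely supported sequence $\sigma=\{\sigma_\ell\}_{\ell\ge0}\in\Bbbk^{\mathbb Z_{\ge0}}=\bigoplus_{\ell\ge0}\Bbbk$ there is a natural transformation $\eta_\sigma:\mathrm{id}\Rightarrow\beta_i^-$ of degree $1$, depending linearly on $\sigma$, given by $\eta^0=\eta^3=\eta^4=\cdots=0$, $$\eta^1(a_{lj}s^\alpha)=\begin{cases}\mathfrak q(a_{lj}s^\alpha)\sum_{\ell}\tfrac12\sigma_\ell\,a_{lj}s^{\alpha+\ell},& l\ne i,\\[2pt] \mathfrak q(a_{ij}s^\alpha)\sum_{\ell}\tfrac12\sigma_\ell\,a_{i+\mathrm{sgn}(j-i),j}s^{\alpha+\ell},& l=i\ne j,\\[2pt] \mathfrak q(s^\alpha)\sum_{\ell}\tfrac12\sigma_\ell\bigl[\tfrac12a_{i-1,i}s^{\alpha+\ell-1},\ \tfrac12a_{i+1,i}s^{\alpha+\ell-1}\bigr],& l=j=i,\end{cases}$$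 where the value lies in the component $T_{i+\mathrm{sgn}(j-i)}$ of $\beta T_i$ in the second case and in $T_{i-1}\oplus T_{i+1}$ in the third, and $$\eta^2(a_{lm}s^\beta,a_{mj}s^\alpha)=\begin{cases}0,&l\neq i,\\ \mathfrak Q(a_{im}s^\beta,a_{mj}s^\alpha)\sum_{\ell}\tfrac12\sigma_\ell\,a_{ij}s^{\beta+\alpha+\delta(j,m,i)+\ell-1},&l=i,\end{cases}$$ with values in the component $T_i$ of $\beta T_i$, where for $a_2=a_{im}s^\beta$, $a_1=a_{mj}s^\alpha$ and $a_2a_1=\mu^2(a_2,a_1)$ $$\mathfrak Q(a_2,a_1)=\begin{cases}\mathrm{sgn}(i-m)\,\mathfrak q(a_2a_1),& m<i<j\text{ or }j<i<m,\\ \mathrm{sgn}(j-i)\tfrac12\,\mathfrak q(a_2),&m=i,\\ \mathrm{sgn}(i-m)\tfrac12\,\mathfrak q(a_2a_1),&j=i,\\ 0,&\text{otherwise.}\end{cases}$$ (The coefficients of the undefined terms $s^{-1}$ are zero.) The classes of the $\eta_\sigma$ are all of the cohomology, each exactly once: $\sigma\mapsto[\eta_\sigma]$ is a linear isomorphism $\Bbbk^{\mathbb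 Z_{\ge0}}\cong\mathrm{HH}^1(\mathfrak B_{i^-})$. -/

import Mathlib

open Polynomial

namespace KLRW

/-!
## The category `𝒞` of the generators `T_0, …, T_n`

The objects are the elements of `Fin (n + 1)` (`n` is the number of punctures).
Every morphism space `Hom(T_i, T_j) = ⨁_α k · a_{ji} s^α` is concentrated in degree `0` and is
stored as the space of polynomials `k[s]`: the monomial `X ^ α` stands for `a_{ji} s^α`.
All `μ^d` with `d ≠ 2` vanish.
-/

/-- The distance `|i - j|` of two labels. -/
def gap {n : ℕ} (i j : Fin (n + 1)) : ℕ := ((i : ℤ) - (j : ℤ)).natAbs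

/-- The sign of `i - j`. -/
def sgn {n : ℕ} (i j : Fin (n + 1)) : ℤ := ((i : ℤ) - (j : ℤ)).sign

/-- The exponent `δ(i,j,l)`: it is `0` if `(i-j)(j-l) ≥ 0`, and `min(|i-j|, |j-l|)` otherwise. -/
def overlap {n : ℕ} (i j l : Fin (n + 1)) : ℕ :=
  if 0 ≤ ((i : ℤ) - (j : ℤ)) * ((j : ℤ) - (l : ℤ)) then 0 else min (gap i j) (gap j l)

/-- The product `μ²(b, a)` of `a ∈ Hom(T_i, T_j)` and `b ∈ Hom(T_j, T_l)`, the bilinear extension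
of `μ²(a_{lj} s^β, a_{ji} s^α) = a_{li} s^{β + α + δ(i,j,l)}`. -/
noncomputable def mul {k : Type*} [Field k] {n : ℕ} (i j l : Fin (n + 1)) (b a : k[X]) : k[X] :=
  X ^ overlap i j l * (b * a)

/-- The `𝔮`-grading `2α + |i - j|` of the morphism `a_{ji} s^α`. -/
def qdeg {n : ℕ} (j i : Fin (n + 1)) (α : ℕ) : ℕ := 2 * α + gap i j

/-!
## Bounded twisted complexes over `𝒞`

A twisted complex has finitely many components, numbered `0, …, len - 1`. A morphism is a matrix
of morphisms of `𝒞`; the entry `f r c` goes from component `c` of the source to component `r` of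
the target. Matrices are stored with rows and columns in `ℕ`, and `TwHom p Y Z` singles out
those that are supported on the components and are homogeneous of degree `p`.
-/

/-- Matrices with entries in `k[s]`. -/
abbrev Mat (k : Type*) [Field k] := ℕ → ℕ → k[X]

/-- The matrix whose only entry is `f`, in row `r` and column `c`. -/
noncomputable def entry {k : Type*} [Field k] (r c : ℕ) (f : k[X]) : Mat k :=
  fun r' c' => if r' = r ∧ c' = c then f else 0

/-- Bounded twisted complexes over `𝒞`. Since the morphisms of `𝒞` have degree `0` and only `μ²`
is nonzero, the differential has entries from cohomological degree `p` to `p + 1` only, and the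
Maurer--Cartan equation reads `δ² = 0`. (The values of `obj` and `deg` at `len` and beyond play
no role.) -/
structure Tw (k : Type*) [Field k] (n : ℕ) where
  len : ℕ
  obj : ℕ → Fin (n + 1)
  deg : ℕ → ℤ
  diff : Mat k
  diff_deg : ∀ r c, diff r c ≠ 0 → r < len ∧ c < len ∧ deg r - deg c = 1
  diff_sq : ∀ r c, ∑ m ∈ Finset.range len, mul (obj c) (obj m) (obj r) (diff r m) (diff m c) = 0

section
variable {k : Type*} [Field k] {n : ℕ}

/-- `Hom^p(Y, Z)` for twisted complexes `Y` and `Z`. -/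
def TwHom (p : ℤ) (Y Z : Tw k n) : Submodule k (Mat k) where
  carrier := {f | ∀ r c, f r c ≠ 0 → r < Z.len ∧ c < Y.len ∧ Z.deg r - Y.deg c = p}
  zero_mem' := by intro r c h; simp at h
  add_mem' := by
    intro f g hf hg r c h
    by_cases h1 : f r c = 0
    · exact hg r c (by intro h2; simp [h1, h2] at h)
    · exact hf r c h1
  smul_mem' := by
    intro a f hf r c h
    exact hf r c (by intro h2; simp [h2] at h)

/-- The composition `g · f` of `f : W → Y` and `g : Y → Z`, without any sign. -/
noncomputable def comp (W Y Z : Tw k n) (g f : Mat k) : Mat k := fun r c =>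
  ∑ m ∈ Finset.range Y.len, mul (W.obj c) (Y.obj m) (Z.obj r) (g r m) (f m c)

/-- `μ¹_δ(f) = (-1)^{|f|} δ · f - f · δ` for `f : Y → Z` of degree `p`. -/
noncomputable def mu1 (Y Z : Tw k n) (p : ℤ) (f : Mat k) : Mat k :=
  p.negOnePow • comp Y Z Z Z.diff f - comp Y Y Z f Y.diff

/-- `μ²_δ(g, f) = (-1)^{|f|} g · f` for `f : W → Y` of degree `p` and `g : Y → Z`. -/
noncomputable def mu2 (W Y Z : Tw k n) (p : ℤ) (g f : Mat k) : Mat k :=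
  p.negOnePow • comp W Y Z g f

/-!
## `A_∞`-functors from `𝒞` to `Tw^b(𝒞)` and their pre-natural transformations

A chain `T_{x 0} → T_{x 1} → ⋯ → T_{x d}` of `d` composable morphisms is given by the sequence
`x` of its objects and the sequence `a` of its morphisms, `a m : T_{x m} → T_{x (m+1)}`; so `a 0`
is the morphism that is usually written `a_1`, and `a (d-1)` is `a_d`.
-/

/-- A family of maps, one for every `d` and every sequence of `d + 1` objects. -/
abbrev Family (k : Type*) [Field k] (n : ℕ) :=
  ∀ d : ℕ, (Fin (d + 1) → Fin (n + 1)) → (Fin d → k[X]) → Mat k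

/-- The first `p` morphisms `(a_p, …, a_1)` of a chain, and the objects between them. -/
def Family.low (φ : Family k n) {d : ℕ} (p : Fin (d + 1)) (x : Fin (d + 1) → Fin (n + 1))
    (a : Fin d → k[X]) : Mat k :=
  φ p (fun m => x ⟨m, by omega⟩) (fun m => a ⟨m, by omega⟩)

/-- The last `d - p` morphisms `(a_d, …, a_{p+1})` of a chain, and the objects between them. -/
def Family.up (φ : Family k n) {d : ℕ} (p : Fin (d + 1)) (x : Fin (d + 1) → Fin (n + 1))
    (a : Fin d → k[X]) : Mat k :=
  φ (d - p) (fun m => x ⟨p + m, by omega⟩) (fun m => a ⟨p + m, by omega⟩)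

/-- The sum over `t` of the terms
`(-1)^{ε + ✠_t} φ^{d-1}(a_d, …, a_{t+3}, μ²(a_{t+2}, a_{t+1}), a_t, …, a_1)`, where
`✠_t = |a_1| + ⋯ + |a_t| - t = -t`. -/
noncomputable def Family.insertMul (φ : Family k n) (ε : ℤ) : Family k n
  | 0, _, _ => 0
  | d + 1, x, a => ∑ t : Fin d, (ε - (t : ℤ)).negOnePow •
      φ d (fun m => x (t.succ.castSucc.succAbove m)) (fun m =>
        if m < t then a m.castSucc
        else if m = t then
          mul (x t.castSucc.castSucc) (x t.succ.castSucc) (x t.succ.succ) (a t.succ) (a t.castSucc)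
        else a m.succ)

/-- The family consists of multilinear maps. -/
def Family.IsMultilinear (φ : Family k n) : Prop :=
  ∀ d x, ∃ f : MultilinearMap k (fun _ : Fin d => k[X]) (Mat k), ∀ a, φ d x a = f a

end

/-- `A_∞`-functors `F : 𝒞 → Tw^b(𝒞)`: the component `F^d = map d` has degree `1 - d`, there is no
`F^0`, and the `A_∞`-equations hold (only `μ²` is nonzero in `𝒞`, and only `μ¹`, `μ²` in
`Tw^b(𝒞)`). -/
structure AInfFunctor (k : Type*) [Field k] (n : ℕ) where
  obj : Fin (n + 1) → Tw k n
  map : Family k n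
  map_zero : ∀ x a, map 0 x a = 0
  multilinear : map.IsMultilinear
  degree : ∀ (d : ℕ) x a, map d x a ∈ TwHom (1 - d) (obj (x 0)) (obj (x (Fin.last d)))
  relation : ∀ (d : ℕ) x a,
    mu1 (obj (x 0)) (obj (x (Fin.last d))) (1 - d) (map d x a)
      + ∑ p : Fin (d + 1), mu2 (obj (x 0)) (obj (x p)) (obj (x (Fin.last d))) (1 - (p : ℕ))
          (map.up p x a) (map.low p x a)
      = map.insertMul 0 d x a

section
variable {k : Type*} [Field k] {n : ℕ}

/-- Pre-natural transformations `F ⇒ G` of degree `g`: families of multilinear maps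
`η^d : Hom(X_{d-1}, X_d) ⊗ ⋯ ⊗ Hom(X_0, X_1) → Hom(F X_0, G X_d)[g - d]`, `d ≥ 0`. -/
def PreNat (F G : AInfFunctor k n) (g : ℤ) : Submodule k (Family k n) where
  carrier := {η | η.IsMultilinear ∧
    ∀ (d : ℕ) x a, η d x a ∈ TwHom (g - d) (F.obj (x 0)) (G.obj (x (Fin.last d)))}
  zero_mem' := ⟨fun _ _ => ⟨0, fun _ => rfl⟩, fun _ _ _ => Submodule.zero_mem _⟩
  add_mem' := by
    rintro η θ ⟨h1, h2⟩ ⟨h3, h4⟩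
    refine ⟨fun d x => ?_, fun d x a => Submodule.add_mem _ (h2 d x a) (h4 d x a)⟩
    obtain ⟨f, hf⟩ := h1 d x
    obtain ⟨f', hf'⟩ := h3 d x
    exact ⟨f + f', fun a => by simp [hf, hf']⟩
  smul_mem' := by
    rintro c η ⟨h1, h2⟩
    refine ⟨fun d x => ?_, fun d x a => Submodule.smul_mem _ c (h2 d x a)⟩
    obtain ⟨f, hf⟩ := h1 d x
    exact ⟨c • f, fun a => by simp [hf]⟩

lemma mul_add' (i j l : Fin (n + 1)) (b a a' : k[X]) :
    mul i j l b (a + a') = mul i j l b a + mul i j l b a' := by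
  simp only [mul]; ring

lemma add_mul' (i j l : Fin (n + 1)) (b b' a : k[X]) :
    mul i j l (b + b') a = mul i j l b a + mul i j l b' a := by
  simp only [mul]; ring

lemma mul_smul' (i j l : Fin (n + 1)) (c : k) (b a : k[X]) :
    mul i j l b (c • a) = c • mul i j l b a := by
  simp only [mul, mul_smul_comm]

lemma smul_mul' (i j l : Fin (n + 1)) (c : k) (b a : k[X]) :
    mul i j l (c • b) a = c • mul i j l b a := by
  simp only [mul, mul_smul_comm, smul_mul_assoc]

lemma comp_add (W Y Z : Tw k n) (g f f' : Mat k) :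
    comp W Y Z g (f + f') = comp W Y Z g f + comp W Y Z g f' := by
  funext r c; simp [comp, mul_add', Finset.sum_add_distrib]

lemma add_comp (W Y Z : Tw k n) (g g' f : Mat k) :
    comp W Y Z (g + g') f = comp W Y Z g f + comp W Y Z g' f := by
  funext r c; simp [comp, add_mul', Finset.sum_add_distrib]

lemma comp_smul (W Y Z : Tw k n) (s : k) (g f : Mat k) :
    comp W Y Z g (s • f) = s • comp W Y Z g f := by
  funext r c; simp [comp, mul_smul', Finset.smul_sum]

lemma smul_comp (W Y Z : Tw k n) (s : k) (g f : Mat k) :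
    comp W Y Z (s • g) f = s • comp W Y Z g f := by
  funext r c; simp [comp, smul_mul', Finset.smul_sum]

/-- The differential `μ¹_{Fun}` on pre-natural transformations `F ⇒ G` of degree `g`:
`(μ¹ η)^d(a_d, …, a_1) = μ¹(η^d(a_d, …, a_1))
  + ∑_p μ²(G^{d-p}(a_d, …, a_{p+1}), η^p(a_p, …, a_1))
  + ∑_p (-1)^{(g-1)✠_p} μ²(η^{d-p}(a_d, …, a_{p+1}), F^p(a_p, …, a_1))
  - ∑_t (-1)^{✠_t + g - 1} η^{d-1}(a_d, …, μ²(a_{t+2}, a_{t+1}), …, a_1)`. -/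
noncomputable def natDiff (F G : AInfFunctor k n) (g : ℤ) : Family k n →ₗ[k] Family k n where
  toFun η := fun d x a =>
    mu1 (F.obj (x 0)) (G.obj (x (Fin.last d))) (g - d) (η d x a)
      + ∑ p : Fin (d + 1), mu2 (F.obj (x 0)) (G.obj (x p)) (G.obj (x (Fin.last d)))
          (g - (p : ℕ)) (G.map.up p x a) (η.low p x a)
      + ∑ p : Fin (d + 1), ((g - 1) * (-(p : ℕ))).negOnePow •
          mu2 (F.obj (x 0)) (F.obj (x p)) (G.obj (x (Fin.last d)))
            (1 - (p : ℕ)) (η.up p x a) (F.map.low p x a)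
      - η.insertMul (g - 1) d x a
  map_add' η θ := by
    have hi : (η + θ).insertMul (g - 1) = η.insertMul (g - 1) + θ.insertMul (g - 1) := by
      funext d x a
      cases d <;> simp [Family.insertMul, Finset.sum_add_distrib]
    funext d x a
    simp only [hi, Pi.add_apply, mu1, mu2, Family.up, Family.low, comp_add, add_comp, smul_add,
      Finset.sum_add_distrib]
    abel
  map_smul' s η := by
    have hi : (s • η).insertMul (g - 1) = s • η.insertMul (g - 1) := by
      funext d x a
      cases d <;> simp [Family.insertMul, Finset.smul_sum, smul_comm s]
    funext d x a
    simp only [hi, Pi.smul_apply, mu1, mu2, Family.up, Family.low, comp_smul, smul_comp,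
      smul_comm _ s, RingHom.id_apply, smul_add, smul_sub, Finset.smul_sum]

/-- `A_∞`-natural transformations `F ⇒ G` of degree `g`: the pre-natural transformations `η` of
degree `g` with `μ¹_{Fun}(η) = 0`. -/
noncomputable def NatTrans (F G : AInfFunctor k n) (g : ℤ) : Submodule k (Family k n) :=
  PreNat F G g ⊓ LinearMap.ker (natDiff F G g)

/-- The coboundaries of degree `g`, inside the natural transformations of degree `g`. -/
noncomputable def coboundaries (F G : AInfFunctor k n) (g : ℤ) : Submodule k (NatTrans F G g) :=
  ((PreNat F G (g - 1)).map (natDiff F G (g - 1))).comap (NatTrans F G g).subtype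

/-- The cohomology in degree `g` of `(Hom_{Fun}(F, G), μ¹_{Fun})`. -/
abbrev HNat (F G : AInfFunctor k n) (g : ℤ) := NatTrans F G g ⧸ coboundaries F G g

/-!
## The two functors
-/

/-- The generator `T_j`, as a twisted complex concentrated in degree `0`. -/
noncomputable def stalk (k : Type*) [Field k] {n : ℕ} (j : Fin (n + 1)) : Tw k n where
  len := 1
  obj _ := j
  deg _ := 0
  diff := 0
  diff_deg := by intro r c h; simp at h
  diff_sq := by intro r c; simp [mul]

lemma entry_apply (r c r' c' : ℕ) (f : k[X]) :
    entry r c f r' c' = if r' = r ∧ c' = c then f else 0 := rfl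

lemma mul_zero' (i j l : Fin (n + 1)) (b : k[X]) : mul i j l b 0 = 0 := by simp [mul]

lemma zero_mul' (i j l : Fin (n + 1)) (b : k[X]) : mul i j l 0 b = 0 := by simp [mul]

lemma comp_entry (W Y Z : Tw k n) (r m m' c : ℕ) (g f : k[X]) :
    comp W Y Z (entry r m g) (entry m' c f) =
      if m = m' ∧ m < Y.len then entry r c (mul (W.obj c) (Y.obj m) (Z.obj r) g f) else 0 := by
  funext r' c'
  by_cases h : m = m' ∧ m < Y.len
  · obtain ⟨rfl, h⟩ := h
    rw [if_pos ⟨rfl, h⟩, comp, Finset.sum_eq_single m]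
    · by_cases h1 : r' = r <;> by_cases h2 : c' = c <;>
        simp [h1, h2, entry_apply, mul_zero', zero_mul']
    · intro b _ hb; simp [hb, entry_apply, mul_zero']
    · intro hm; simp at hm; omega
  · rw [if_neg h]
    apply Finset.sum_eq_zero
    intro b hb
    simp at hb
    by_cases h1 : b = m
    · by_cases h2 : b = m'
      · exact absurd ⟨h1.symm.trans h2, h1 ▸ hb⟩ h
      · rw [entry_apply m', if_neg (fun hh => h2 hh.1), mul_zero']
    · rw [entry_apply r, if_neg (fun hh => h1 hh.2), zero_mul']

lemma entry_add (r c : ℕ) (f g : k[X]) : entry r c (f + g) = entry r c f + entry r c g := by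
  funext r' c'; simp only [entry_apply, Pi.add_apply]; split_ifs <;> simp

lemma entry_smul (r c : ℕ) (s : k) (f : k[X]) : entry r c (s • f) = s • entry r c f := by
  funext r' c'; simp only [entry_apply, Pi.smul_apply]; split_ifs <;> simp

lemma entry_neg (r c : ℕ) (f : k[X]) : entry r c (-f) = -entry r c f := by
  funext r' c'; simp only [entry_apply, Pi.neg_apply]; split_ifs <;> simp

lemma entry_zero (r c : ℕ) : entry r c (0 : k[X]) = 0 := by
  funext r' c'; simp [entry_apply]

lemma comp_zero (W Y Z : Tw k n) (g : Mat k) : comp W Y Z g 0 = 0 := by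
  funext r c; simp [comp, mul_zero']

lemma zero_comp (W Y Z : Tw k n) (g : Mat k) : comp W Y Z 0 g = 0 := by
  funext r c; simp [comp, zero_mul']

lemma comp_neg (W Y Z : Tw k n) (g f : Mat k) : comp W Y Z g (-f) = -comp W Y Z g f := by
  funext r c; simp [comp, mul]

lemma neg_comp (W Y Z : Tw k n) (g f : Mat k) : comp W Y Z (-g) f = -comp W Y Z g f := by
  funext r c; simp [comp, mul]

lemma entry_mem {p : ℤ} {Y Z : Tw k n} {r c : ℕ} (f : k[X]) (hr : r < Z.len) (hc : c < Y.len)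
    (h : Z.deg r - Y.deg c = p) : entry r c f ∈ TwHom p Y Z := by
  intro r' c' h'
  simp only [entry_apply] at h'
  split_ifs at h' with h1
  · obtain ⟨rfl, rfl⟩ := h1; exact ⟨hr, hc, h⟩
  · simp at h'

lemma overlap_of_left_le {i j l : Fin (n + 1)} (h1 : (i : ℕ) ≤ j) (h2 : (i : ℕ) ≤ l) :
    overlap i j l = (j : ℕ) - (l : ℕ) := by
  unfold overlap gap
  split_ifs with h
  · rcases mul_nonneg_iff.1 h with h | h <;> omega
  · rcases mul_neg_iff.1 (not_le.1 h) with h | h <;> omega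

lemma overlap_of_left_ge {i j l : Fin (n + 1)} (h1 : (j : ℕ) ≤ i) (h2 : (l : ℕ) ≤ i) :
    overlap i j l = (l : ℕ) - (j : ℕ) := by
  unfold overlap gap
  split_ifs with h
  · rcases mul_nonneg_iff.1 h with h | h <;> omega
  · rcases mul_neg_iff.1 (not_le.1 h) with h | h <;> omega

lemma overlap_of_right_le {i j l : Fin (n + 1)} (h1 : (l : ℕ) ≤ j) (h2 : (l : ℕ) ≤ i) :
    overlap i j l = (j : ℕ) - (i : ℕ) := by
  unfold overlap gap
  split_ifs with h
  · rcases mul_nonneg_iff.1 h with h | h <;> omega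
  · rcases mul_neg_iff.1 (not_le.1 h) with h | h <;> omega

lemma overlap_of_right_ge {i j l : Fin (n + 1)} (h1 : (j : ℕ) ≤ l) (h2 : (i : ℕ) ≤ l) :
    overlap i j l = (i : ℕ) - (j : ℕ) := by
  unfold overlap gap
  split_ifs with h
  · rcases mul_nonneg_iff.1 h with h | h <;> omega
  · rcases mul_neg_iff.1 (not_le.1 h) with h | h <;> omega

lemma overlap_eq (i j l : Fin (n + 1)) :
    overlap i j l = ((j : ℕ) - max (i : ℕ) l) + (min (i : ℕ) l - (j : ℕ)) := by
  unfold overlap gap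
  split_ifs with h
  · rcases mul_nonneg_iff.1 h with h | h <;> omega
  · rcases mul_neg_iff.1 (not_le.1 h) with h | h <;> omega

lemma gap_of_le {i j : Fin (n + 1)} (h : (i : ℕ) ≤ j) : gap i j = (j : ℕ) - (i : ℕ) := by
  unfold gap; omega

lemma gap_of_ge {i j : Fin (n + 1)} (h : (j : ℕ) ≤ i) : gap i j = (i : ℕ) - (j : ℕ) := by
  unfold gap; omega

lemma X_nf1 (a b : ℕ) (p : k[X]) : X ^ a * (X ^ b * p) = X ^ (a + b) * p := by ring
lemma X_nf2 (a : ℕ) (p : k[X]) : X ^ a * (X * p) = X ^ (a + 1) * p := by ring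
lemma X_nf6 (a : ℕ) (p : k[X]) : X * (X ^ a * p) = X ^ (a + 1) * p := by ring
lemma X_nf3 (a b : ℕ) (p q : k[X]) : X ^ a * (p * (X ^ b * q)) = X ^ (a + b) * (p * q) := by ring
lemma X_nf4 (a : ℕ) (p q : k[X]) : X ^ a * (p * (X * q)) = X ^ (a + 1) * (p * q) := by ring
lemma X_nf5 (a : ℕ) (p q r : k[X]) :
    X ^ a * (p * (q * (X * r))) = X ^ (a + 1) * (p * (q * r)) := by ring

/-- The twisted complex `T_i → T_{i-1} ⊕ T_{i+1}` with `T_i` in degree `-1` (component `0`),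
`T_{i-1}` and `T_{i+1}` in degree `0` (components `1` and `2`), and differential
`[a_{i-1,i}, -a_{i+1,i}]`. -/
noncomputable def braidObj (k : Type*) [Field k] {n : ℕ} (i : Fin (n + 1)) (h0 : 0 < (i : ℕ))
    (h1 : (i : ℕ) < n) : Tw k n where
  len := 3
  obj m := if m = 0 then i else if m = 1 then ⟨i - 1, by omega⟩ else ⟨i + 1, by omega⟩
  deg m := if m = 0 then -1 else 0
  diff := entry 1 0 1 + entry 2 0 (-1)
  diff_deg := by
    intro r c h
    simp only [Pi.add_apply, entry_apply] at h
    by_cases h1 : r = 1 ∧ c = 0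
    · simp [h1.1, h1.2]
    · by_cases h2 : r = 2 ∧ c = 0
      · simp [h2.1, h2.2]
      · simp [h1, h2] at h
  diff_sq := by
    intro r c
    apply Finset.sum_eq_zero
    intro m _
    by_cases hm : m = 0
    · subst hm; simp [entry_apply, mul_zero']
    · simp [entry_apply, hm, zero_mul']

/-- The first component `β¹` of the negative braiding functor: its value on the morphism
`f : T_j → T_l`. -/
noncomputable def braid1 (i j l : Fin (n + 1)) (f : k[X]) : Mat k :=
  if j = i then
    if l = i then entry 0 0 f + entry 1 1 f + entry 2 2 f
    else if i < l then entry 0 1 f + entry 0 2 (X * f)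
    else entry 0 1 (X * f) + entry 0 2 f
  else if l = i then
    if i < j then entry 2 0 f else entry 1 0 f
  else entry 0 0 f

/-- The second component `β²` of the negative braiding functor: its value on the morphisms
`f : T_j → T_m` and `g : T_m → T_l`. It is nonzero only for `l = i`, and takes values in the
degree `-1` component `T_i` of `T_i → T_{i-1} ⊕ T_{i+1}`. -/
noncomputable def braid2 (i j m l : Fin (n + 1)) (g f : k[X]) : Mat k :=
  if l = i then
    if j = i then
      if m < i then entry 0 2 (X ^ (gap i m - 1) * (g * f))
      else if i < m then entry 0 1 (-(X ^ (gap i m - 1) * (g * f)))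
      else 0
    else if m < i ∧ i < j then entry 0 0 (X ^ (gap i m - 1) * (g * f))
    else if j < i ∧ i < m then entry 0 0 (-(X ^ (gap i m - 1) * (g * f)))
    else 0
  else 0

noncomputable def braidObjs (k : Type*) [Field k] {n : ℕ} (i : Fin (n + 1)) (h0 : 0 < (i : ℕ))
    (h1 : (i : ℕ) < n) (j : Fin (n + 1)) : Tw k n :=
  if j = i then braidObj k i h0 h1 else stalk k j

noncomputable def braidMap (k : Type*) [Field k] {n : ℕ} (i : Fin (n + 1)) : Family k n
  | 1, x, a => braid1 i (x 0) (x 1) (a 0)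
  | 2, x, a => braid2 i (x 0) (x 1) (x 2) (a 1) (a 0)
  | _, _, _ => 0

lemma stalk_len (j : Fin (n + 1)) : (stalk k j).len = 1 := rfl
lemma stalk_obj (j : Fin (n + 1)) (m : ℕ) : (stalk k j).obj m = j := rfl
lemma stalk_diff (j : Fin (n + 1)) : (stalk k j).diff = 0 := rfl

section
variable (i : Fin (n + 1)) (h0 : 0 < (i : ℕ)) (h1 : (i : ℕ) < n)

lemma braidObj_len : (braidObj k i h0 h1).len = 3 := rfl
lemma braidObj_obj0 : (braidObj k i h0 h1).obj 0 = i := rfl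
lemma braidObj_obj1 : (braidObj k i h0 h1).obj 1 = ⟨i - 1, by omega⟩ := rfl
lemma braidObj_obj2 : (braidObj k i h0 h1).obj 2 = ⟨i + 1, by omega⟩ := rfl
lemma braidObj_diff : (braidObj k i h0 h1).diff = entry 1 0 1 + -entry 2 0 1 := by
  rw [← entry_neg]; rfl
lemma braidObjs_self : braidObjs k i h0 h1 i = braidObj k i h0 h1 := if_pos rfl
lemma braidObjs_ne {j : Fin (n + 1)} (h : j ≠ i) : braidObjs k i h0 h1 j = stalk k j := if_neg h

end

lemma entry_congr (r c : ℕ) {e e' : ℕ} (p : k[X]) (h : e = e') :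
    entry r c (X ^ e * p) = entry r c (X ^ e' * p) := by rw [h]

lemma braid_rel1 (i : Fin (n + 1)) (h0 : 0 < (i : ℕ)) (h1 : (i : ℕ) < n) (j l : Fin (n + 1))
    (f : k[X]) :
    comp (braidObjs k i h0 h1 j) (braidObjs k i h0 h1 l) (braidObjs k i h0 h1 l)
      (braidObjs k i h0 h1 l).diff (braid1 i j l f) =
    comp (braidObjs k i h0 h1 j) (braidObjs k i h0 h1 j) (braidObjs k i h0 h1 l)
      (braid1 i j l f) (braidObjs k i h0 h1 j).diff := by
  have e1 : (i : ℕ) - (i + 1) = 0 := by omega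
  have e2 : (i : ℕ) + 1 - i = 1 := by omega
  have e3 : (i : ℕ) - 1 - i = 0 := by omega
  have e4 : (i : ℕ) - (i - 1) = 1 := by omega
  rcases lt_trichotomy j i with hj | hj | hj <;> rcases lt_trichotomy l i with hl | hl | hl <;>
    (try have hj1 := hj.ne) <;> (try have hj2 := hj.ne') <;> (try have hj3 := hj.not_gt) <;>
    (try have hl1 := hl.ne) <;> (try have hl2 := hl.ne') <;> (try have hl3 := hl.not_gt) <;>
    simp [braid1, *, stalk_obj, stalk_diff, braidObj_len, braidObj_obj0,
      braidObj_obj1, braidObj_obj2, braidObj_diff, braidObjs_self, braidObjs_ne, ne_eq,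
       comp_zero, zero_comp, comp_add, add_comp,
      comp_entry, mul, X_nf2, comp_neg, neg_comp] <;>
    simp (disch := first | omega | (dsimp only; omega)) only [overlap_of_left_le, overlap_of_left_ge, overlap_of_right_le,
        overlap_of_right_ge, e1, e2, e3, e4, pow_zero, pow_one, one_mul,
        Nat.sub_eq_zero_of_le, zero_add] <;> grind

lemma braid_rel2 (i : Fin (n + 1)) (h0 : 0 < (i : ℕ)) (h1 : (i : ℕ) < n) (j m l : Fin (n + 1))
    (g f : k[X]) :
    comp (braidObjs k i h0 h1 j) (braidObjs k i h0 h1 m) (braidObjs k i h0 h1 l)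
      (braid1 i m l g) (braid1 i j m f) =
    comp (braidObjs k i h0 h1 j) (braidObjs k i h0 h1 l) (braidObjs k i h0 h1 l)
      (braidObjs k i h0 h1 l).diff (braid2 i j m l g f) +
    comp (braidObjs k i h0 h1 j) (braidObjs k i h0 h1 j) (braidObjs k i h0 h1 l)
      (braid2 i j m l g f) (braidObjs k i h0 h1 j).diff + braid1 i j l (mul j m l g f) := by
  rcases lt_trichotomy j i with hj | hj | hj <;> rcases lt_trichotomy l i with hl | hl | hl <;>
    rcases lt_trichotomy m i with hm | hm | hm <;>
    (try have hj1 := hj.ne) <;> (try have hj2 := hj.ne') <;> (try have hj3 := hj.not_gt) <;>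
    (try have hl1 := hl.ne) <;> (try have hl2 := hl.ne') <;> (try have hl3 := hl.not_gt) <;>
    (try have hm1 := hm.ne) <;> (try have hm2 := hm.ne') <;> (try have hm3 := hm.not_gt) <;>
    simp [braid1, braid2, *, stalk_len, stalk_obj, stalk_diff, braidObj_len, braidObj_obj0,
      braidObj_obj1, braidObj_obj2, braidObj_diff, braidObjs_self, braidObjs_ne, ne_eq,
       comp_zero, zero_comp, comp_add, add_comp,
      comp_entry, mul, entry_neg, X_nf1, X_nf2, X_nf4, X_nf6, mul_assoc,
      comp_neg, neg_comp] <;>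
    (try simp (disch := first | omega | (dsimp only; omega)) only [overlap_of_left_le,
        overlap_of_left_ge, overlap_of_right_le, overlap_of_right_ge, gap_of_le, gap_of_ge]) <;>
    first
      | exact entry_congr _ _ _ (by omega)
      | exact entry_congr _ _ _ (by simp only [overlap_eq]; omega)
      | exact congrArg₂ (· + ·) (entry_congr _ _ _ (by omega))
          (entry_congr _ _ _ (by omega))
      | grind

lemma braid_rel3 (i : Fin (n + 1)) (h0 : 0 < (i : ℕ)) (h1 : (i : ℕ) < n) (j m l q : Fin (n + 1))
    (h g f : k[X]) :
    comp (braidObjs k i h0 h1 j) (braidObjs k i h0 h1 m) (braidObjs k i h0 h1 q)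
      (braid2 i m l q h g) (braid1 i j m f) -
    comp (braidObjs k i h0 h1 j) (braidObjs k i h0 h1 l) (braidObjs k i h0 h1 q)
      (braid1 i l q h) (braid2 i j m l g f) =
    braid2 i j l q h (mul j m l g f) - braid2 i j m q (mul m l q h g) f := by
  by_cases hq : q = i
  · rcases lt_trichotomy j i with hj | hj | hj <;> rcases lt_trichotomy l i with hl | hl | hl <;>
      rcases lt_trichotomy m i with hm | hm | hm <;>
      (try have hj1 := hj.ne) <;> (try have hj2 := hj.ne') <;> (try have hj3 := hj.not_gt) <;>
      (try have hl1 := hl.ne) <;> (try have hl2 := hl.ne') <;> (try have hl3 := hl.not_gt) <;>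
      (try have hm1 := hm.ne) <;> (try have hm2 := hm.ne') <;> (try have hm3 := hm.not_gt) <;>
      simp [braid1, braid2, *, stalk_len, stalk_obj, braidObj_len, braidObj_obj0,
      braidObj_obj1, braidObj_obj2, braidObjs_self, braidObjs_ne, ne_eq,
       comp_zero, zero_comp, comp_add,
        add_comp, comp_entry, mul, entry_neg, X_nf1, X_nf3, X_nf5, mul_assoc,
        comp_neg, neg_comp] <;>
      (try clear hj1 hj2) <;> (try clear hl1 hl2) <;> (try clear hm1 hm2) <;>
      (try clear hj3) <;> (try clear hl3) <;> (try clear hm3) <;>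
      simp (disch := first | omega | (dsimp only; omega)) only [overlap_of_left_le, overlap_of_left_ge, overlap_of_right_le,
        overlap_of_right_ge, gap_of_le, gap_of_ge] <;>
      first
        | exact entry_congr _ _ _ (by omega)
        | exact (neg_add_eq_zero.2 (entry_congr _ _ _ (by omega))).symm
        | exact (sub_eq_zero.2 (entry_congr _ _ _ (by omega))).symm
        | exact (add_comm _ _).trans (congrArg₂ (· + ·) (entry_congr _ _ _ (by omega))
            (entry_congr _ _ _ (by omega)))
        | exact (congrArg₂ (· + ·) (congrArg _ (entry_congr _ _ _ (by omega)))
            (congrArg _ (entry_congr _ _ _ (by omega)))).trans (sub_eq_add_neg _ _).symm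
  · have e2 : ∀ g f : k[X], braid2 i m l q g f = 0 := fun g f => if_neg hq
    have e3 : braid2 i j l q h (mul j m l g f) = 0 := if_neg hq
    have e4 : braid2 i j m q (mul m l q h g) f = 0 := if_neg hq
    rw [e2, e3, e4, zero_comp, sub_zero, zero_sub, neg_eq_zero]
    by_cases hl : l = i
    · have e1 : ∃ p p' : k[X], braid1 i l q h = entry 0 1 p + entry 0 2 p' := by
        simp only [braid1, if_pos hl, if_neg hq]
        split_ifs <;> exact ⟨_, _, rfl⟩
      obtain ⟨p, p', e1⟩ := e1
      rw [e1]
      simp only [braid2, if_pos hl]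
      split_ifs <;> simp [add_comp, comp_entry, comp_zero]
    · simp [braid2, hl, comp_zero]

lemma multilinear_one {F : k[X] → Mat k} (φ : (Fin 1 → k[X]) → Mat k)
    (h : ∀ a, φ a = F (a 0)) (hadd : ∀ f g, F (f + g) = F f + F g)
    (hsmul : ∀ (c : k) f, F (c • f) = c • F f) :
    ∃ f : MultilinearMap k (fun _ : Fin 1 => k[X]) (Mat k), ∀ a, φ a = f a := by
  refine ⟨MultilinearMap.mk (fun a => F (a 0)) ?_ ?_, h⟩
  · intro _ m p f g
    obtain rfl : p = 0 := Subsingleton.elim _ _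
    simp [hadd]
  · intro _ m p c f
    obtain rfl : p = 0 := Subsingleton.elim _ _
    simp [hsmul]

lemma multilinear_two {F : k[X] → Mat k} (φ : (Fin 2 → k[X]) → Mat k)
    (h : ∀ a, φ a = F (a 1 * a 0)) (hadd : ∀ f g, F (f + g) = F f + F g)
    (hsmul : ∀ (c : k) f, F (c • f) = c • F f) :
    ∃ f : MultilinearMap k (fun _ : Fin 2 => k[X]) (Mat k), ∀ a, φ a = f a := by
  refine ⟨MultilinearMap.mk (fun a => F (a 1 * a 0)) ?_ ?_, h⟩
  · intro _ m p f g
    fin_cases p <;> simp [add_mul, mul_add, hadd]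
  · intro _ m p c f
    fin_cases p <;> simp [hsmul]

lemma Family.low_eq_zero {φ : Family k n} {K d : ℕ} (h : ∀ e, K < e → φ e = 0) {p : Fin (d + 1)}
    (hp : K < (p : ℕ)) (x : Fin (d + 1) → Fin (n + 1)) (a : Fin d → k[X]) : φ.low p x a = 0 := by
  rw [Family.low, h _ hp]; rfl

lemma Family.up_eq_zero {φ : Family k n} {K d : ℕ} (h : ∀ e, K < e → φ e = 0) {p : Fin (d + 1)}
    (hp : K < d - (p : ℕ)) (x : Fin (d + 1) → Fin (n + 1)) (a : Fin d → k[X]) :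
    φ.up p x a = 0 := by
  rw [Family.up, h _ hp]; rfl

lemma Family.insertMul_eq_zero {φ : Family k n} {K d : ℕ} (h : ∀ e, K < e → φ e = 0)
    (hd : K + 1 < d) (ε : ℤ) (x : Fin (d + 1) → Fin (n + 1)) (a : Fin d → k[X]) :
    φ.insertMul ε d x a = 0 := by
  obtain _ | d := d
  · rfl
  · simp [Family.insertMul, h d (by omega)]

lemma comp_up_low_eq_zero {φ : Family k n} {K d : ℕ} (h : ∀ e, K < e → φ e = 0)
    (p : Fin (d + 1)) (hp : K < (p : ℕ) ∨ K < d - (p : ℕ)) (W Y Z : Tw k n)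
    (x : Fin (d + 1) → Fin (n + 1)) (a : Fin d → k[X]) :
    comp W Y Z (φ.up p x a) (φ.low p x a) = 0 := by
  rcases hp with hp | hp
  · rw [Family.low_eq_zero h hp, comp_zero]
  · rw [Family.up_eq_zero h hp, zero_comp]

/-- The identity functor, restricted to the generators: `T_j ↦ T_j`, with `F¹` the identity and
`F^d = 0` for `d ≠ 1`. -/
noncomputable def inclMap (k : Type*) [Field k] (n : ℕ) : Family k n
  | 1, _, a => entry 0 0 (a 0)
  | _, _, _ => 0

noncomputable def incl (k : Type*) [Field k] (n : ℕ) : AInfFunctor k n where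
  obj := stalk k
  map := inclMap k n
  map_zero _ _ := rfl
  multilinear := by
    intro d x
    match d with
    | 0 => exact ⟨0, fun _ => rfl⟩
    | 1 => exact multilinear_one _ (fun _ => rfl) (entry_add 0 0) (entry_smul 0 0)
    | d + 2 => exact ⟨0, fun _ => rfl⟩
  degree := by
    intro d x a
    match d with
    | 0 => exact Submodule.zero_mem _
    | 1 => exact entry_mem _ Nat.one_pos Nat.one_pos rfl
    | d + 2 => exact Submodule.zero_mem _
  relation := by
    intro d x a
    match d with
    | 0 => simp [mu1, mu2, Family.up, Family.low, Family.insertMul, inclMap, comp_zero, zero_comp]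
    | 1 =>
      simp [mu1, mu2, Family.up, Family.low, Family.insertMul, inclMap, comp_zero, zero_comp,
        Fin.sum_univ_succ, stalk_diff]
    | 2 =>
      simp [mu1, mu2, Family.up, Family.low, Family.insertMul, inclMap, comp_zero,
        Fin.sum_univ_succ, stalk_diff, comp_entry, stalk_len, stalk_obj]
    | d + 3 =>
      have h : ∀ e, 1 < e → inclMap k n e = 0 := fun e he => by
        obtain _ | _ | e := e
        · omega
        · omega
        · rfl
      rw [Family.insertMul_eq_zero h (by omega), h _ (by omega)]
      simp only [mu2]
      rw [Finset.sum_eq_zero fun p _ => by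
        rw [comp_up_low_eq_zero h p (by omega), smul_zero]]
      simp [mu1, comp_zero, zero_comp]

lemma braid_rel4 (i : Fin (n + 1)) (h0 : 0 < (i : ℕ)) (h1 : (i : ℕ) < n) (j m l q r : Fin (n + 1))
    (h' h g f : k[X]) :
    comp (braidObjs k i h0 h1 j) (braidObjs k i h0 h1 l) (braidObjs k i h0 h1 r)
      (braid2 i l q r h' h) (braid2 i j m l g f) = 0 := by
  unfold braid2
  split_ifs <;> simp [comp_zero, zero_comp, comp_entry]

/-- The functor `β_i^-` on the generators, for `0 < i < n`. -/
noncomputable def negBraid (k : Type*) [Field k] {n : ℕ} (i : Fin (n + 1)) (h0 : 0 < (i : ℕ))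
    (h1 : (i : ℕ) < n) : AInfFunctor k n where
  obj := braidObjs k i h0 h1
  map := braidMap k i
  map_zero _ _ := rfl
  multilinear := by
    intro d x
    match d with
    | 0 => exact ⟨0, fun _ => rfl⟩
    | 1 =>
      refine multilinear_one (F := braid1 i (x 0) (x 1)) _ (fun _ => rfl) (fun f g => ?_)
        (fun c f => ?_)
      · simp only [braid1]
        split_ifs <;> simp only [entry_add, mul_add] <;> abel
      · simp only [braid1]
        split_ifs <;> simp only [entry_smul, mul_smul_comm, smul_add]
    | 2 =>
      refine multilinear_two (F := fun f => braid2 i (x 0) (x 1) (x 2) 1 f) _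
        (fun _ => by simp [braidMap, braid2]) (fun f g => ?_) (fun c f => ?_)
      · simp only [braid2, one_mul]
        split_ifs <;> simp only [entry_add, entry_neg, mul_add, neg_add, add_zero]
      · simp only [braid2, one_mul]
        split_ifs <;> simp only [entry_smul, entry_neg, mul_smul_comm, smul_neg, smul_zero]
    | d + 3 => exact ⟨0, fun _ => rfl⟩
  degree := by
    intro d x a
    match d with
    | 0 => exact Submodule.zero_mem _
    | 1 =>
      simp only [braidMap, braid1]
      split_ifs <;> (repeat' apply Submodule.add_mem) <;> apply entry_mem <;>
        simp_all [braidObjs, braidObj, stalk, Fin.last]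
    | 2 =>
      simp only [braidMap, braid2]
      split_ifs <;> (first | exact Submodule.zero_mem _ | apply entry_mem) <;>
        simp_all [braidObjs, braidObj, stalk, Fin.last]
    | d + 3 => exact Submodule.zero_mem _
  relation := by
    intro d x a
    match d with
    | 0 => simp [mu1, mu2, Family.up, Family.low, Family.insertMul, braidMap, comp_zero, zero_comp]
    | 1 =>
      simp [mu1, mu2, Family.up, Family.low, Family.insertMul, braidMap, comp_zero, zero_comp,
        Fin.sum_univ_succ, sub_eq_zero]
      exact braid_rel1 i h0 h1 _ _ _
    | 2 =>
      have h := braid_rel2 i h0 h1 (x 0) (x 1) (x 2) (a 1) (a 0)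
      simp [mu1, mu2, Family.up, Family.low, Family.insertMul, braidMap, comp_zero, zero_comp,
        Fin.sum_univ_succ]
      rw [h]
      abel
    | 3 =>
      have h := braid_rel3 i h0 h1 (x 0) (x 1) (x 2) (x 3) (a 2) (a 1) (a 0)
      simp [mu1, mu2, Family.up, Family.low, Family.insertMul, braidMap, comp_zero, zero_comp,
        Fin.sum_univ_succ]
      exact (sub_eq_add_neg _ _).symm.trans (h.trans (sub_eq_add_neg _ _))
    | d + 4 =>
      have h : ∀ e, 2 < e → braidMap k i e = 0 := fun e he => by
        obtain _ | _ | _ | e := e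
        · omega
        · omega
        · omega
        · rfl
      rw [Family.insertMul_eq_zero h (by omega), h _ (by omega)]
      simp only [mu2]
      rw [Finset.sum_eq_zero fun p _ => by
        by_cases hp : 2 < (p : ℕ) ∨ 2 < d + 4 - (p : ℕ)
        · rw [comp_up_low_eq_zero h p hp, smul_zero]
        · obtain rfl : d = 0 := by omega
          obtain rfl : p = 2 := by apply Fin.ext; show (p : ℕ) = 2; omega
          exact (congrArg _ (braid_rel4 i h0 h1 _ _ _ _ _ _ _ _ _)).trans (smul_zero _)]
      simp [mu1, comp_zero, zero_comp]

/-!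
## The explicit transformations of degree 1

`σ = {σ_ℓ}_{ℓ ≥ 0}` is an element of `⨁_{ℓ ≥ 0} k`, that is, a finitely supported sequence.
-/

/-- `∑_ℓ (1/2) σ_ℓ s^{e + ℓ}`. -/
noncomputable def halfSum (σ : ℕ →₀ k) (e : ℕ) : k[X] :=
  σ.sum fun ℓ c => C (2⁻¹ * c) * X ^ (e + ℓ)

/-- `∑_ℓ (1/2) σ_ℓ s^{e + ℓ - 1}`. Where this is used with `e = 0`, its coefficient vanishes, so
the value of the truncated exponent `0 + 0 - 1` does not matter. -/
noncomputable def halfSumPred (σ : ℕ →₀ k) (e : ℕ) : k[X] :=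
  σ.sum fun ℓ c => C (2⁻¹ * c) * X ^ (e + ℓ - 1)

/-- The value of `η¹` on `a_{lj} s^α : T_j → T_l`. -/
noncomputable def eta1 (i : Fin (n + 1)) (σ : ℕ →₀ k) (j l : Fin (n + 1)) (α : ℕ) : Mat k :=
  if l ≠ i then entry 0 0 ((qdeg l j α : k) • halfSum σ α)
  else if j < i then entry 1 0 ((qdeg i j α : k) • halfSum σ α)
  else if i < j then entry 2 0 ((qdeg i j α : k) • halfSum σ α)
  else entry 1 0 ((qdeg i i α : k) • (2⁻¹ : k) • halfSumPred σ α)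
    + entry 2 0 ((qdeg i i α : k) • (2⁻¹ : k) • halfSumPred σ α)

/-- The coefficient `𝔔(a_{im} s^β, a_{mj} s^α)`; the product of the two morphisms is
`a_{ij} s^{β + α + δ(j,m,i)}`. -/
noncomputable def coeffQ (k : Type*) [Field k] (i j m : Fin (n + 1)) (β α : ℕ) : k :=
  if (m < i ∧ i < j) ∨ (j < i ∧ i < m) then
    (sgn i m : k) * (qdeg i j (β + α + overlap j m i) : k)
  else if m = i then (sgn j i : k) * 2⁻¹ * (qdeg i m β : k)
  else if j = i then (sgn i m : k) * 2⁻¹ * (qdeg i j (β + α + overlap j m i) : k)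
  else 0

/-- The value of `η²` on `a_{lm} s^β : T_m → T_l` and `a_{mj} s^α : T_j → T_m`. -/
noncomputable def eta2 (i : Fin (n + 1)) (σ : ℕ →₀ k) (j m l : Fin (n + 1)) (β α : ℕ) : Mat k :=
  if l = i then entry 0 0 (coeffQ k i j m β α • halfSumPred σ (β + α + overlap j m i)) else 0

end

end KLRW

/-!
The complex `Hom(T_j, β T_l)` lives in degrees `-1` and `0`, and its differential is injective.
Multiplication on the left by a closed row vector, namely `(0, s, 1)` on `β T_i`, followed by the
faithful functor `a_{lj} s^α ↦ s^{α + max(l - j, 0)}` from `𝒞` to `k[s]`, embeds the cokernel of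
that differential into `k[s]`. Hence a natural transformation of degree `1` is determined up to
coboundaries by its image in `k[s]`, which is a derivation of `𝒞`, and coboundaries correspond to
inner derivations. A derivation of `𝒞` into `k[s]` is an inner one plus a multiple of the Euler
derivation, which multiplies a homogeneous morphism by its `𝔮`-degree. Conversely `η²` is recovered
from `η¹` by solving `μ¹(η²(a₂, a₁)) = ` (the failure of `η¹` to be a derivation at `(a₂, a₁)`), so
each `p(s) • Euler` lifts to a unique class, represented by `η_σ` with `p = ∑ ½ σ_ℓ s^ℓ`.
-/

namespace KLRW

section Category

variable {k : Type*} [Field k] {n : ℕ}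

/-- The faithful functor `a_{lj} s^α ↦ s^{α + max(l - j, 0)}` from `𝒞` to the monoid algebra
`k[s]`, regarded as a category with one object. The truncated subtraction of naturals computes
`max(l - j, 0)`. -/
noncomputable def embed (j l : Fin (n + 1)) : k[X] →ₗ[k] k[X] :=
  LinearMap.mulLeft k (X ^ ((l : ℕ) - (j : ℕ)))

lemma embed_apply (j l : Fin (n + 1)) (f : k[X]) :
    embed j l f = X ^ ((l : ℕ) - (j : ℕ)) * f := rfl

lemma embed_self (j : Fin (n + 1)) (f : k[X]) : embed j j f = f := by
  rw [embed_apply, Nat.sub_self, pow_zero, one_mul]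

lemma embed_injective (j l : Fin (n + 1)) : Function.Injective (embed (k := k) j l) :=
  mul_right_injective₀ (pow_ne_zero _ X_ne_zero)

lemma embed_mul (j m l : Fin (n + 1)) (g f : k[X]) :
    embed j l (mul j m l g f) = embed m l g * embed j m f := by
  have exponents : (l : ℕ) - j + overlap j m l = (l - m) + (m - j) := by
    rw [overlap_eq]; omega
  simp only [embed_apply, mul]
  rw [← mul_assoc, ← pow_add, exponents, pow_add]
  ring

lemma mul_assoc' (j m l q : Fin (n + 1)) (h g f : k[X]) :
    mul j m q (mul m l q h g) f = mul j l q h (mul j m l g f) :=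
  embed_injective j q (by simp only [embed_mul, mul_assoc])

lemma mul_id_left (j l : Fin (n + 1)) (g f : k[X]) : mul j l l g f = g * f :=
  embed_injective j l (by rw [embed_mul, embed_self, embed_apply, embed_apply]; ring)

lemma mul_id_right (j l : Fin (n + 1)) (g f : k[X]) : mul j j l g f = g * f :=
  embed_injective j l (by rw [embed_mul, embed_self, embed_apply, embed_apply]; ring)

lemma mul_sum' {ι : Type*} (s : Finset ι) (i j l : Fin (n + 1)) (b : k[X]) (a : ι → k[X]) :
    mul i j l b (∑ m ∈ s, a m) = ∑ m ∈ s, mul i j l b (a m) := by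
  simp only [mul, Finset.mul_sum]

lemma sum_mul' {ι : Type*} (s : Finset ι) (i j l : Fin (n + 1)) (b : ι → k[X]) (a : k[X]) :
    mul i j l (∑ m ∈ s, b m) a = ∑ m ∈ s, mul i j l (b m) a := by
  simp only [mul, Finset.mul_sum, Finset.sum_mul]

lemma comp_assoc (V W Y Z : Tw k n) (h g f : Mat k) :
    comp V W Z (comp W Y Z h g) f = comp V Y Z h (comp V W Y g f) := by
  funext r c
  simp only [comp, mul_sum', sum_mul', mul_assoc']
  exact Finset.sum_comm

/-- The composition of matrices of morphisms, as a bilinear map. -/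
noncomputable def compₗ (W Y Z : Tw k n) : Mat k →ₗ[k] Mat k →ₗ[k] Mat k :=
  LinearMap.mk₂ k (comp W Y Z) (add_comp W Y Z) (smul_comp W Y Z) (comp_add W Y Z)
    (comp_smul W Y Z)

/-- `entry r c`, as a linear map. -/
noncomputable def entryₗ (r c : ℕ) : k[X] →ₗ[k] Mat k where
  toFun := entry r c
  map_add' := entry_add r c
  map_smul' := entry_smul r c

lemma comp_mem {W Y Z : Tw k n} {p q : ℤ} {g f : Mat k} (hg : g ∈ TwHom q Y Z)
    (hf : f ∈ TwHom p W Y) : comp W Y Z g f ∈ TwHom (q + p) W Z := by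
  intro r c h
  obtain ⟨m, -, hm⟩ := Finset.exists_ne_zero_of_sum_ne_zero h
  have hgm := hg r m fun h => hm (by rw [h, zero_mul'])
  have hfm := hf m c fun h => hm (by rw [h, mul_zero'])
  exact ⟨hgm.1, hfm.2.1, by omega⟩

lemma mu1_mem {Y Z : Tw k n} {p : ℤ} {f : Mat k} (hf : f ∈ TwHom p Y Z) :
    mu1 Y Z p f ∈ TwHom (p + 1) Y Z :=
  Submodule.sub_mem _ (Submodule.smul_of_tower_mem _ _ (add_comm 1 p ▸ comp_mem Z.diff_deg hf))
    (comp_mem hf Y.diff_deg)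

lemma mu2_mem {W Y Z : Tw k n} {p q : ℤ} {g f : Mat k} (hg : g ∈ TwHom q Y Z)
    (hf : f ∈ TwHom p W Y) (r : ℤ) : mu2 W Y Z r g f ∈ TwHom (q + p) W Z :=
  Submodule.smul_of_tower_mem _ _ (comp_mem hg hf)

end Category

section Degree

variable {k : Type*} [Field k] {n : ℕ} {φ : Family k n} {src tgt : Fin (n + 1) → Tw k n} {g : ℤ}

/-- A family of degree `g` from `src` to `tgt`: the component `φ^d` takes values in
`Hom(src X_0, tgt X_d)[g - d]`. Functors have degree `1` in this sense. -/
def Family.HasDegree (φ : Family k n) (src tgt : Fin (n + 1) → Tw k n) (g : ℤ) : Prop :=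
  ∀ (d : ℕ) x a, φ d x a ∈ TwHom (g - d) (src (x 0)) (tgt (x (Fin.last d)))

namespace Family.HasDegree

lemma low_mem (hφ : φ.HasDegree src tgt g) {d : ℕ} (p : Fin (d + 1))
    (x : Fin (d + 1) → Fin (n + 1)) (a : Fin d → k[X]) :
    φ.low p x a ∈ TwHom (g - (p : ℕ)) (src (x 0)) (tgt (x p)) :=
  hφ _ _ _

lemma up_mem (hφ : φ.HasDegree src tgt g) {d : ℕ} (p : Fin (d + 1))
    (x : Fin (d + 1) → Fin (n + 1)) (a : Fin d → k[X]) :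
    φ.up p x a ∈ TwHom (g - (d - (p : ℕ))) (src (x p)) (tgt (x (Fin.last d))) := by
  have hp : (p : ℕ) ≤ d := Nat.lt_succ_iff.1 p.isLt
  have hlast : (⟨p + (Fin.last (d - p) : ℕ), by simp only [Fin.val_last]; omega⟩ : Fin (d + 1)) =
      Fin.last d := Fin.ext (by simp [hp])
  have h := hφ (d - p) (fun m => x ⟨p + m, by omega⟩) (fun m => a ⟨p + m, by omega⟩)
  rwa [hlast, Nat.cast_sub hp] at h

lemma insertMul_mem (hφ : φ.HasDegree src tgt g) (ε : ℤ) (d : ℕ)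
    (x : Fin (d + 1) → Fin (n + 1)) (a : Fin d → k[X]) :
    φ.insertMul ε d x a ∈ TwHom (g + 1 - d) (src (x 0)) (tgt (x (Fin.last d))) := by
  obtain _ | d := d
  · exact Submodule.zero_mem _
  · refine Submodule.sum_mem _ fun t _ => Submodule.smul_of_tower_mem _ _ ?_
    have hfirst : t.succ.castSucc.succAbove 0 = 0 := by
      simp [Fin.succAbove, Fin.lt_def]
    have hlast : t.succ.castSucc.succAbove (Fin.last d) = Fin.last (d + 1) := by
      simp [Fin.succAbove, Fin.lt_def, Nat.not_lt.2 t.isLt]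
    have hdeg : g + 1 - ((d + 1 : ℕ) : ℤ) = g - d := by push_cast; ring
    rw [hdeg, ← hlast]
    nth_rw 1 [← hfirst]
    exact hφ d _ _

end Family.HasDegree

lemma natDiff_hasDegree {F G : AInfFunctor k n} {η : Family k n}
    (hη : η.HasDegree F.obj G.obj g) :
    (natDiff F G g η).HasDegree F.obj G.obj (g + 1) := by
  have hF : F.map.HasDegree F.obj F.obj 1 := F.degree
  have hG : G.map.HasDegree G.obj G.obj 1 := G.degree
  intro d x a
  refine Submodule.sub_mem _ (Submodule.add_mem _ (Submodule.add_mem _ ?_ ?_) ?_)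
    (hη.insertMul_mem _ d x a)
  · convert mu1_mem (hη d x a) using 2; ring
  · refine Submodule.sum_mem _ fun p _ => ?_
    convert mu2_mem (hG.up_mem p x a) (hη.low_mem p x a) _ using 2; ring
  · refine Submodule.sum_mem _ fun p _ => Submodule.smul_of_tower_mem _ _ ?_
    convert mu2_mem (hη.up_mem p x a) (hF.low_mem p x a) _ using 2; ring

end Degree

section Families

variable {k : Type*} [Field k] {n : ℕ} {φ : Family k n}

namespace Family.IsMultilinear

/-- The component of arity `1` of a multilinear family, as a family of linear maps. -/
noncomputable def one (hφ : φ.IsMultilinear) (j l : Fin (n + 1)) : k[X] →ₗ[k] Mat k where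
  toFun f := φ 1 ![j, l] ![f]
  map_add' f f' := by
    obtain ⟨L, hL⟩ := hφ 1 ![j, l]
    simp only [hL]; exact L.cons_add ![] f f'
  map_smul' c f := by
    obtain ⟨L, hL⟩ := hφ 1 ![j, l]
    simp only [hL]; exact L.cons_smul ![] c f

/-- The component of arity `2` of a multilinear family, as a family of bilinear maps of which the
first argument is the morphism composed last. -/
noncomputable def two (hφ : φ.IsMultilinear) (j m l : Fin (n + 1)) :
    k[X] →ₗ[k] k[X] →ₗ[k] Mat k :=
  LinearMap.mk₂ k (fun g f => φ 2 ![j, m, l] ![f, g])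
    (fun g g' f => by
      obtain ⟨L, hL⟩ := hφ 2 ![j, m, l]
      simp only [hL]; exact (L.curryLeft f).cons_add ![] g g')
    (fun c g f => by
      obtain ⟨L, hL⟩ := hφ 2 ![j, m, l]
      simp only [hL]; exact (L.curryLeft f).cons_smul ![] c g)
    (fun g f f' => by
      obtain ⟨L, hL⟩ := hφ 2 ![j, m, l]
      simp only [hL]; exact L.cons_add ![g] f f')
    (fun c g f => by
      obtain ⟨L, hL⟩ := hφ 2 ![j, m, l]
      simp only [hL]; exact L.cons_smul ![g] c f)

lemma one_apply (hφ : φ.IsMultilinear) (x : Fin 2 → Fin (n + 1)) (a : Fin 1 → k[X]) :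
    φ 1 x a = hφ.one (x 0) (x 1) (a 0) := by
  change φ 1 x a = φ 1 ![x 0, x 1] ![a 0]
  congr 1 <;> funext m <;> fin_cases m <;> rfl

lemma two_apply (hφ : φ.IsMultilinear) (x : Fin 3 → Fin (n + 1)) (a : Fin 2 → k[X]) :
    φ 2 x a = hφ.two (x 0) (x 1) (x 2) (a 1) (a 0) := by
  change φ 2 x a = φ 2 ![x 0, x 1, x 2] ![a 0, a 1]
  congr 1 <;> funext m <;> fin_cases m <;> rfl

end Family.IsMultilinear

/-- The family with components `F0`, `F1`, `F2` in arities `0`, `1`, `2`, and zero otherwise. -/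
noncomputable def fam (F0 : Fin (n + 1) → Mat k)
    (F1 : ∀ _ _ : Fin (n + 1), k[X] →ₗ[k] Mat k)
    (F2 : ∀ _ _ _ : Fin (n + 1), k[X] →ₗ[k] k[X] →ₗ[k] Mat k) : Family k n
  | 0, x, _ => F0 (x 0)
  | 1, x, a => F1 (x 0) (x 1) (a 0)
  | 2, x, a => F2 (x 0) (x 1) (x 2) (a 1) (a 0)
  | _ + 3, _, _ => 0

variable {F0 : Fin (n + 1) → Mat k} {F1 : ∀ _ _ : Fin (n + 1), k[X] →ₗ[k] Mat k}
  {F2 : ∀ _ _ _ : Fin (n + 1), k[X] →ₗ[k] k[X] →ₗ[k] Mat k}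

lemma fam_isMultilinear : (fam F0 F1 F2).IsMultilinear
  | 0, x => ⟨MultilinearMap.constOfIsEmpty k _ (F0 (x 0)), fun _ => rfl⟩
  | 1, x => ⟨LinearMap.compMultilinearMap (F1 (x 0) (x 1))
      (MultilinearMap.ofSubsingleton k k[X] k[X] 0 LinearMap.id), fun _ => rfl⟩
  | 2, x => ⟨MultilinearMap.mk (fun a => F2 (x 0) (x 1) (x 2) (a 1) (a 0))
      (fun a t f f' => by fin_cases t <;> simp) (fun a t c f => by fin_cases t <;> simp),
      fun _ => rfl⟩
  | _ + 3, _ => ⟨0, fun _ => rfl⟩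

lemma Family.IsMultilinear.eq_fam (hφ : φ.IsMultilinear) (h : ∀ d x a, φ (d + 3) x a = 0) :
    φ = fam (fun j => φ 0 ![j] ![]) hφ.one hφ.two := by
  funext d x a
  match d with
  | 0 =>
    change φ 0 x a = φ 0 ![x 0] ![]
    congr 1
    · funext m; fin_cases m; rfl
    · exact Subsingleton.elim _ _
  | 1 => exact hφ.one_apply x a
  | 2 => exact hφ.two_apply x a
  | d + 3 => exact h d x a

end Families

section Bimodule

variable {k : Type*} [Field k] {n : ℕ} (G : AInfFunctor k n)

namespace AInfFunctor

/-- The `𝒞`-bimodule `(j, l) ↦ Hom(T_j, G T_l)`, in degree `p`. -/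
noncomputable abbrev bimodule (p : ℤ) (j l : Fin (n + 1)) : Submodule k (Mat k) :=
  TwHom p (stalk k j) (G.obj l)

/-- The differential of `Hom(T_j, G T_l)`, without its sign. -/
noncomputable def homDiff (j l : Fin (n + 1)) : Mat k →ₗ[k] Mat k :=
  compₗ (stalk k j) (G.obj l) (G.obj l) (G.obj l).diff

/-- The left action `(g, f) ↦ G¹(g) · f` of `g : T_m → T_l` on `f : T_j → G T_m`. -/
noncomputable def postcomp (j m l : Fin (n + 1)) : k[X] →ₗ[k] Mat k →ₗ[k] Mat k :=
  compₗ (stalk k j) (G.obj m) (G.obj l) ∘ₗ G.multilinear.one m l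

/-- The operation `f ↦ G²(h, g) · f` on `f : T_j → G T_m`, for `g : T_m → T_l` and
`h : T_l → T_q`. By the functor equations it is a homotopy which measures the failure of `postcomp`
to be an action of `𝒞`. -/
noncomputable def postcomp₂ (j m l q : Fin (n + 1)) (h g : k[X]) : Mat k →ₗ[k] Mat k :=
  compₗ (stalk k j) (G.obj m) (G.obj q) (G.multilinear.two m l q h g)

/-- The right action `(g, f) ↦ g · f` of `f : T_j → T_m` on `g : T_m → G T_l`. -/
noncomputable def precomp (j m l : Fin (n + 1)) : Mat k →ₗ[k] k[X] →ₗ[k] Mat k :=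
  (compₗ (stalk k j) (stalk k m) (G.obj l)).compl₂ (entryₗ 0 0)

variable {G} {p : ℤ} {j m l q : Fin (n + 1)}

lemma homDiff_mem {f : Mat k} (hf : f ∈ G.bimodule p j l) :
    G.homDiff j l f ∈ G.bimodule (p + 1) j l :=
  add_comm 1 p ▸ comp_mem (G.obj l).diff_deg hf

lemma postcomp_mem (g : k[X]) {f : Mat k} (hf : f ∈ G.bimodule p j m) :
    G.postcomp j m l g f ∈ G.bimodule p j l :=
  zero_add p ▸ comp_mem (G.degree 1 ![m, l] ![g]) hf

lemma postcomp₂_mem (h g : k[X]) {f : Mat k} (hf : f ∈ G.bimodule p j m) :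
    G.postcomp₂ j m l q h g f ∈ G.bimodule (p - 1) j q :=
  neg_add_eq_sub 1 p ▸ comp_mem (G.degree 2 ![m, l, q] ![g, h]) hf

lemma precomp_mem {g : Mat k} (hg : g ∈ G.bimodule p m l) (f : k[X]) :
    G.precomp j m l g f ∈ G.bimodule p j l :=
  add_zero p ▸ comp_mem hg (entry_mem f Nat.one_pos Nat.one_pos rfl)

variable (G j m l q)

lemma homDiff_postcomp (g : k[X]) (f : Mat k) :
    G.homDiff j l (G.postcomp j m l g f) = G.postcomp j m l g (G.homDiff j m f) := by
  have functor_eq : comp (G.obj m) (G.obj l) (G.obj l) (G.obj l).diff (G.multilinear.one m l g) =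
      comp (G.obj m) (G.obj m) (G.obj l) (G.multilinear.one m l g) (G.obj m).diff := by
    simpa [mu1, mu2, Family.up, Family.low, Family.insertMul, Fin.sum_univ_succ, G.map_zero,
      G.multilinear.one_apply, comp_zero, zero_comp, sub_eq_zero] using
      G.relation 1 ![m, l] ![g]
  change comp _ _ _ _ (comp _ _ _ _ f) = comp _ _ _ _ (comp _ _ _ _ f)
  rw [← comp_assoc, functor_eq, comp_assoc]

lemma homDiff_postcomp₂ (h g : k[X]) (f : Mat k) :
    G.homDiff j q (G.postcomp₂ j m l q h g f) =
      G.postcomp j l q h (G.postcomp j m l g f) - G.postcomp j m q (mul m l q h g) f -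
        G.postcomp₂ j m l q h g (G.homDiff j m f) := by
  have functor_eq : comp (G.obj m) (G.obj q) (G.obj q) (G.obj q).diff
        (G.multilinear.two m l q h g) =
      comp (G.obj m) (G.obj l) (G.obj q) (G.multilinear.one l q h) (G.multilinear.one m l g) +
        -G.multilinear.one m q (mul m l q h g) +
        -comp (G.obj m) (G.obj m) (G.obj q) (G.multilinear.two m l q h g) (G.obj m).diff := by
    have relation : -comp (G.obj m) (G.obj q) (G.obj q) (G.obj q).diff
            (G.multilinear.two m l q h g) -
          comp (G.obj m) (G.obj m) (G.obj q) (G.multilinear.two m l q h g) (G.obj m).diff +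
        comp (G.obj m) (G.obj l) (G.obj q) (G.multilinear.one l q h) (G.multilinear.one m l g) =
          G.multilinear.one m q (mul m l q h g) := by
      simpa [mu1, mu2, Family.up, Family.low, Family.insertMul, Fin.sum_univ_succ, G.map_zero,
        G.multilinear.one_apply, G.multilinear.two_apply, comp_zero, zero_comp] using
        G.relation 2 ![m, l, q] ![g, h]
    rw [← relation]
    abel
  change comp _ _ _ _ (comp _ _ _ _ f) =
    comp _ _ _ _ (comp _ _ _ _ f) - comp _ _ _ _ f - comp _ _ _ _ (comp _ _ _ _ f)
  rw [← comp_assoc, functor_eq, add_comp, add_comp, neg_comp, neg_comp, comp_assoc, comp_assoc,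
    ← sub_eq_add_neg, ← sub_eq_add_neg]

lemma homDiff_precomp (g : Mat k) (f : k[X]) :
    G.homDiff j l (G.precomp j m l g f) = G.precomp j m l (G.homDiff m l g) f :=
  (comp_assoc _ _ _ _ _ _ _).symm

lemma precomp_postcomp (h : k[X]) (g : Mat k) (f : k[X]) :
    G.precomp j m q (G.postcomp m l q h g) f = G.postcomp j l q h (G.precomp j m l g f) :=
  comp_assoc _ _ _ _ _ _ _

lemma precomp_precomp (h : Mat k) (g f : k[X]) :
    G.precomp j m q (G.precomp m l q h g) f = G.precomp j l q h (mul j m l g f) := by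
  have entries : comp (stalk k j) (stalk k m) (stalk k l) (entry 0 0 g) (entry 0 0 f) =
      entry 0 0 (mul j m l g f) := by
    rw [comp_entry, if_pos ⟨rfl, Nat.one_pos⟩]; rfl
  exact (comp_assoc _ _ _ _ _ _ _).trans (congrArg _ entries)

end AInfFunctor
end Bimodule

section Components

variable {k : Type*} [Field k] {n : ℕ}

/-- The product of `𝒞`, as a bilinear map. -/
noncomputable def mulₗ (j m l : Fin (n + 1)) : k[X] →ₗ[k] k[X] →ₗ[k] k[X] :=
  LinearMap.mk₂ k (mul j m l) (add_mul' j m l) (smul_mul' j m l) (mul_add' j m l) (mul_smul' j m l)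

namespace AInfFunctor
variable (G : AInfFunctor k n)

/-- The failure `(g, f) ↦ g · F(f) + F(g) · f - F(gf)` of a family of maps
`F : Hom(T_j, T_l) → Hom(T_j, G T_l)` to be a derivation. -/
noncomputable def leibniz (F : ∀ _ _ : Fin (n + 1), k[X] →ₗ[k] Mat k) (j m l : Fin (n + 1)) :
    k[X] →ₗ[k] k[X] →ₗ[k] Mat k :=
  (G.postcomp j m l).compl₂ (F j m) + G.precomp j m l ∘ₗ F m l - (mulₗ j m l).compr₂ (F j l)

/-- The inner derivation `f ↦ f · Z_j - Z_l · f` given by a family of morphisms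
`Z_j : T_j → G T_j`. -/
noncomputable def innerDer (Z : Fin (n + 1) → Mat k) (j l : Fin (n + 1)) : k[X] →ₗ[k] Mat k :=
  (G.postcomp j j l).flip (Z j) - G.precomp j l l (Z l)

variable {G}

lemma leibniz_apply (F : ∀ _ _ : Fin (n + 1), k[X] →ₗ[k] Mat k) (j m l : Fin (n + 1))
    (g f : k[X]) :
    G.leibniz F j m l g f = G.postcomp j m l g (F j m f) + G.precomp j m l (F m l g) f -
      F j l (mul j m l g f) := rfl

lemma innerDer_apply (Z : Fin (n + 1) → Mat k) (j l : Fin (n + 1)) (f : k[X]) :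
    G.innerDer Z j l f = G.postcomp j j l f (Z j) - G.precomp j l l (Z l) f := rfl

variable {F0 Z0 : Fin (n + 1) → Mat k} {F1 Z1 : ∀ _ _ : Fin (n + 1), k[X] →ₗ[k] Mat k}
  {F2 : ∀ _ _ _ : Fin (n + 1), k[X] →ₗ[k] k[X] →ₗ[k] Mat k} {p : ℤ}

lemma leibniz_mem (hF : ∀ j l f, F1 j l f ∈ G.bimodule p j l) (j m l : Fin (n + 1)) (g f : k[X]) :
    G.leibniz F1 j m l g f ∈ G.bimodule p j l :=
  sub_mem (add_mem (postcomp_mem g (hF j m f)) (precomp_mem (hF m l g) f)) (hF j l _)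

lemma innerDer_mem (hZ : ∀ j, Z0 j ∈ G.bimodule p j j) (j l : Fin (n + 1)) (f : k[X]) :
    G.innerDer Z0 j l f ∈ G.bimodule p j l :=
  sub_mem (postcomp_mem f (hZ j)) (precomp_mem (hZ l) f)

lemma natDiff_fam_two (x : Fin 3 → Fin (n + 1)) (a : Fin 2 → k[X]) :
    natDiff (incl k n) G 1 (fam 0 F1 F2) 2 x a =
      G.leibniz F1 (x 0) (x 1) (x 2) (a 1) (a 0) -
        G.homDiff (x 0) (x 2) (F2 (x 0) (x 1) (x 2) (a 1) (a 0)) := by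
  simp [natDiff, mu1, mu2, Family.up, Family.low, Family.insertMul, fam, Fin.sum_univ_succ,
    G.map_zero, G.multilinear.one_apply, incl, inclMap, stalk_diff, comp_zero, zero_comp,
    leibniz_apply, homDiff, postcomp, precomp, compₗ, entryₗ]
  abel

lemma natDiff_fam_three (x : Fin 4 → Fin (n + 1)) (a : Fin 3 → k[X]) :
    natDiff (incl k n) G 1 (fam 0 F1 F2) 3 x a =
      G.postcomp₂ (x 0) (x 1) (x 2) (x 3) (a 2) (a 1) (F1 (x 0) (x 1) (a 0)) -
        G.postcomp (x 0) (x 2) (x 3) (a 2) (F2 (x 0) (x 1) (x 2) (a 1) (a 0)) +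
        G.precomp (x 0) (x 1) (x 3) (F2 (x 1) (x 2) (x 3) (a 2) (a 1)) (a 0) -
        F2 (x 0) (x 2) (x 3) (a 2) (mul (x 0) (x 1) (x 2) (a 1) (a 0)) +
        F2 (x 0) (x 1) (x 3) (mul (x 1) (x 2) (x 3) (a 2) (a 1)) (a 0) := by
  simp [natDiff, mu1, mu2, Family.up, Family.low, Family.insertMul, fam, Fin.sum_univ_succ,
    G.multilinear.one_apply, G.multilinear.two_apply, incl, inclMap, stalk_diff,
    comp_zero, postcomp, postcomp₂, precomp, compₗ, entryₗ]
  abel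

lemma natDiff_fam_zero_one (x : Fin 2 → Fin (n + 1)) (a : Fin 1 → k[X]) :
    natDiff (incl k n) G 0 (fam Z0 Z1 0) 1 x a =
      G.innerDer Z0 (x 0) (x 1) (a 0) - G.homDiff (x 0) (x 1) (Z1 (x 0) (x 1) (a 0)) := by
  simp [natDiff, mu1, mu2, Family.up, Family.low, Family.insertMul, fam, Fin.sum_univ_succ,
    G.map_zero, G.multilinear.one_apply, incl, inclMap, stalk_diff, comp_zero, zero_comp,
    innerDer_apply, homDiff, postcomp, precomp, compₗ, entryₗ]
  abel

lemma natDiff_fam_zero_two (x : Fin 3 → Fin (n + 1)) (a : Fin 2 → k[X]) :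
    natDiff (incl k n) G 0 (fam Z0 Z1 0) 2 x a =
      G.postcomp₂ (x 0) (x 0) (x 1) (x 2) (a 1) (a 0) (Z0 (x 0)) -
        G.leibniz Z1 (x 0) (x 1) (x 2) (a 1) (a 0) := by
  simp [natDiff, mu1, mu2, Family.up, Family.low, Family.insertMul, fam, Fin.sum_univ_succ,
    G.map_zero, G.multilinear.one_apply, G.multilinear.two_apply, incl, inclMap, stalk_diff,
    comp_zero, leibniz_apply, postcomp, postcomp₂, precomp, compₗ, entryₗ]
  abel

end AInfFunctor
end Components

section TwoTerm

variable {k : Type*} [Field k] {n : ℕ} {G : AInfFunctor k n}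

namespace AInfFunctor

/-- The bimodule `Hom(T_j, G T_l)` lives in degrees `-1` and `0`, and its differential is
injective, so that it is a resolution of the cokernel of this differential. -/
structure IsTwoTerm (G : AInfFunctor k n) : Prop where
  eq_zero : ∀ {p : ℤ} {j l f}, f ∈ G.bimodule p j l → p ≠ 0 → p ≠ -1 → f = 0
  injective : ∀ {j l f f'}, f ∈ G.bimodule (-1) j l → f' ∈ G.bimodule (-1) j l →
    G.homDiff j l f = G.homDiff j l f' → f = f'

variable {F0 Z0 : Fin (n + 1) → Mat k} {F1 Z1 : ∀ _ _ : Fin (n + 1), k[X] →ₗ[k] Mat k}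
  {F2 : ∀ _ _ _ : Fin (n + 1), k[X] →ₗ[k] k[X] →ₗ[k] Mat k} {g : ℤ}

lemma fam_mem_preNat (h0 : ∀ j, F0 j ∈ G.bimodule g j j)
    (h1 : ∀ j l f, F1 j l f ∈ G.bimodule (g - 1) j l)
    (h2 : ∀ j m l f f', F2 j m l f f' ∈ G.bimodule (g - 2) j l) :
    fam F0 F1 F2 ∈ PreNat (incl k n) G g := by
  refine ⟨fam_isMultilinear, fun d x a => ?_⟩
  match d with
  | 0 => exact (sub_zero g).symm ▸ h0 (x 0)
  | 1 => exact h1 (x 0) (x 1) (a 0)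
  | 2 => exact h2 (x 0) (x 1) (x 2) (a 1) (a 0)
  | d + 3 => exact Submodule.zero_mem _

namespace IsTwoTerm
variable (hG : G.IsTwoTerm)
include hG

lemma homDiff_eq_zero {j l : Fin (n + 1)} {f : Mat k} (hf : f ∈ G.bimodule 0 j l) :
    G.homDiff j l f = 0 :=
  hG.eq_zero (homDiff_mem hf) (by norm_num) (by norm_num)

lemma apply_eq_zero {η : Family k n} (hη : η.HasDegree (incl k n).obj G.obj g) {d : ℕ}
    (x : Fin (d + 1) → Fin (n + 1)) (a : Fin d → k[X]) (hd : g - d ≠ 0) (hd' : g - d ≠ -1) :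
    η d x a = 0 :=
  hG.eq_zero (hη d x a) hd hd'

lemma exists_eq_fam {η : Family k n} (hη : η ∈ PreNat (incl k n) G g) (hg : g ≤ 1) :
    ∃ F0 F1 F2, (∀ j, F0 j ∈ G.bimodule g j j) ∧ (∀ j l f, F1 j l f ∈ G.bimodule (g - 1) j l) ∧
      (∀ j m l f f', F2 j m l f f' ∈ G.bimodule (g - 2) j l) ∧ η = fam F0 F1 F2 := by
  refine ⟨fun j => η 0 ![j] ![], hη.1.one, hη.1.two, fun j => ?_,
    fun j l f => hη.2 1 ![j, l] ![f], fun j m l f f' => hη.2 2 ![j, m, l] ![f', f],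
    hη.1.eq_fam fun d x a => hG.apply_eq_zero hη.2 x a ?_ ?_⟩
  · exact sub_zero g ▸ hη.2 0 ![j] ![]
  all_goals push_cast; omega

lemma exists_eq_fam_zero {ζ : Family k n} (hζ : ζ ∈ PreNat (incl k n) G 0) :
    ∃ Z0 Z1, (∀ j, Z0 j ∈ G.bimodule 0 j j) ∧ (∀ j l f, Z1 j l f ∈ G.bimodule (-1) j l) ∧
      ζ = fam Z0 Z1 0 := by
  obtain ⟨Z0, Z1, Z2, h0, h1, h2, rfl⟩ := hG.exists_eq_fam hζ zero_le_one
  obtain rfl : Z2 = 0 := by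
    funext j m l
    refine LinearMap.ext₂ fun f f' => ?_
    exact hG.eq_zero (h2 j m l f f') (by norm_num) (by norm_num)
  exact ⟨Z0, Z1, h0, h1, rfl⟩

lemma exists_eq_fam_one {η : Family k n} (hη : η ∈ PreNat (incl k n) G 1) :
    ∃ F1 F2, (∀ j l f, F1 j l f ∈ G.bimodule 0 j l) ∧
      (∀ j m l f f', F2 j m l f f' ∈ G.bimodule (-1) j l) ∧ η = fam 0 F1 F2 := by
  obtain ⟨F0, F1, F2, h0, h1, h2, rfl⟩ := hG.exists_eq_fam hη le_rfl
  obtain rfl : F0 = 0 := funext fun j => hG.eq_zero (h0 j) (by norm_num) (by norm_num)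
  exact ⟨F1, F2, h1, h2, rfl⟩

lemma cocycle_of_homDiff_eq_leibniz (h1 : ∀ j l f, F1 j l f ∈ G.bimodule 0 j l)
    (h2 : ∀ j m l f f', F2 j m l f f' ∈ G.bimodule (-1) j l)
    (hF : ∀ j m l f f', G.homDiff j l (F2 j m l f f') = G.leibniz F1 j m l f f')
    (j m l q : Fin (n + 1)) (h g f : k[X]) :
    G.postcomp₂ j m l q h g (F1 j m f) - G.postcomp j l q h (F2 j m l g f) +
      G.precomp j m q (F2 m l q h g) f - F2 j l q h (mul j m l g f) +
      F2 j m q (mul m l q h g) f = 0 := by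
  refine hG.injective (j := j) (l := q) (add_mem (sub_mem (add_mem (sub_mem ?_ ?_) ?_) ?_) ?_)
    (Submodule.zero_mem _) ?_
  · exact postcomp₂_mem h g (h1 j m f)
  · exact postcomp_mem h (h2 j m l g f)
  · exact precomp_mem (h2 m l q h g) f
  · exact h2 _ _ _ _ _
  · exact h2 _ _ _ _ _
  · simp only [map_add, map_sub, LinearMap.map_zero, LinearMap.add_apply, LinearMap.sub_apply,
      homDiff_postcomp₂, homDiff_postcomp, homDiff_precomp, hG.homDiff_eq_zero (h1 _ _ _), hF,
      leibniz_apply, precomp_postcomp, precomp_precomp, mul_assoc']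
    abel

lemma fam_mem_natTrans_iff (h1 : ∀ j l f, F1 j l f ∈ G.bimodule 0 j l)
    (h2 : ∀ j m l f f', F2 j m l f f' ∈ G.bimodule (-1) j l) :
    fam 0 F1 F2 ∈ NatTrans (incl k n) G 1 ↔
      ∀ j m l g f, G.homDiff j l (F2 j m l g f) = G.leibniz F1 j m l g f := by
  have hpre : fam 0 F1 F2 ∈ PreNat (incl k n) G 1 :=
    fam_mem_preNat (fun _ => Submodule.zero_mem _) h1 h2
  constructor
  · intro h j m l g f
    have closed := congrFun₃ (LinearMap.mem_ker.1 h.2) 2 ![j, m, l] ![f, g]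
    exact (sub_eq_zero.1 ((natDiff_fam_two ![j, m, l] ![f, g]).symm.trans closed)).symm
  · intro hF
    refine ⟨hpre, LinearMap.mem_ker.2 (funext fun d => funext fun x => funext fun a => ?_)⟩
    have hdeg := natDiff_hasDegree hpre.2
    match d with
    | 0 => exact hG.apply_eq_zero hdeg x a (by norm_num) (by norm_num)
    | 1 => exact hG.apply_eq_zero hdeg x a (by norm_num) (by norm_num)
    | 2 => rw [natDiff_fam_two, hF, sub_self]; rfl
    | 3 => rw [natDiff_fam_three]; exact hG.cocycle_of_homDiff_eq_leibniz h1 h2 hF _ _ _ _ _ _ _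
    | d + 4 => exact hG.apply_eq_zero hdeg x a (by push_cast; omega) (by push_cast; omega)

lemma exists_eq_fam_of_mem_natTrans {η : Family k n} (hη : η ∈ NatTrans (incl k n) G 1) :
    ∃ F1 F2, (∀ j l f, F1 j l f ∈ G.bimodule 0 j l) ∧
      (∀ j m l f f', F2 j m l f f' ∈ G.bimodule (-1) j l) ∧
      (∀ j m l g f, G.homDiff j l (F2 j m l g f) = G.leibniz F1 j m l g f) ∧ η = fam 0 F1 F2 := by
  obtain ⟨F1, F2, hF1, hF2, rfl⟩ := hG.exists_eq_fam_one hη.1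
  exact ⟨F1, F2, hF1, hF2, (hG.fam_mem_natTrans_iff hF1 hF2).1 hη, rfl⟩

lemma natDiff_fam_zero_eq
    (h2 : ∀ j m l f f', F2 j m l f f' ∈ G.bimodule (-1) j l)
    (hF : ∀ j m l g f, G.homDiff j l (F2 j m l g f) = G.leibniz F1 j m l g f)
    (hZ0 : ∀ j, Z0 j ∈ G.bimodule 0 j j) (hZ1 : ∀ j l f, Z1 j l f ∈ G.bimodule (-1) j l)
    (hFZ : ∀ j l f, F1 j l f = G.innerDer Z0 j l f - G.homDiff j l (Z1 j l f)) :
    natDiff (incl k n) G 0 (fam Z0 Z1 0) = fam 0 F1 F2 := by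
  have hpre : fam Z0 Z1 0 ∈ PreNat (incl k n) G 0 :=
    fam_mem_preNat hZ0 hZ1 fun _ _ _ _ _ => Submodule.zero_mem _
  have hcomponent_two : ∀ j m l g f,
      G.postcomp₂ j j m l g f (Z0 j) - G.leibniz Z1 j m l g f = F2 j m l g f := by
    intro j m l g f
    refine hG.injective (sub_mem ?_ (leibniz_mem hZ1 j m l g f)) (h2 j m l g f) ?_
    · exact postcomp₂_mem g f (hZ0 j)
    · simp only [hF, leibniz_apply, hFZ, map_add, map_sub, LinearMap.sub_apply,
        homDiff_postcomp₂, homDiff_postcomp, homDiff_precomp, hG.homDiff_eq_zero (hZ0 _),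
        LinearMap.map_zero, innerDer_apply, precomp_postcomp, precomp_precomp]
      abel
  funext d x a
  have hdeg := natDiff_hasDegree hpre.2
  match d with
  | 0 => exact hG.apply_eq_zero hdeg x a (by norm_num) (by norm_num)
  | 1 => rw [natDiff_fam_zero_one, ← hFZ]; rfl
  | 2 => rw [natDiff_fam_zero_two, hcomponent_two]; rfl
  | d + 3 => exact hG.apply_eq_zero hdeg x a (by push_cast; omega) (by push_cast; omega)

end IsTwoTerm
end AInfFunctor
end TwoTerm

section Derivations

variable {k : Type*} [Field k] {n : ℕ}

/-- Multiplication of each morphism `a_{lj} s^α` of `𝒞` by its `𝔮`-degree `2α + |l - j|`. -/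
noncomputable def qgrade (j l : Fin (n + 1)) : k[X] →ₗ[k] k[X] where
  toFun f := 2 * (X * derivative f) + (gap j l : k[X]) * f
  map_add' f g := by rw [derivative_add]; ring
  map_smul' c f := by
    simp only [derivative_smul, mul_smul_comm, smul_add, RingHom.id_apply]

lemma qgrade_apply (j l : Fin (n + 1)) (f : k[X]) :
    qgrade j l f = 2 * (X * derivative f) + (gap j l : k[X]) * f := rfl

lemma qgrade_X_pow (j l : Fin (n + 1)) (α : ℕ) :
    qgrade j l (X ^ α : k[X]) = (qdeg l j α : k) • X ^ α := by
  rw [qgrade_apply, derivative_X_pow, Nat.cast_smul_eq_nsmul, nsmul_eq_mul, qdeg]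
  obtain _ | α := α
  · simp
  · simp only [map_natCast, Nat.add_sub_cancel]
    push_cast
    ring

lemma gap_add_two_mul_overlap (j m l : Fin (n + 1)) :
    gap j l + 2 * overlap j m l = gap j m + gap m l := by
  rw [overlap_eq, gap, gap, gap]; omega

lemma qgrade_mul (j m l : Fin (n + 1)) (g f : k[X]) :
    qgrade j l (mul j m l g f) = mul j m l g (qgrade j m f) + mul j m l (qgrade m l g) f := by
  have weight : (gap j l : k[X]) + 2 * (overlap j m l : k[X]) = gap j m + gap m l := by
    exact_mod_cast congrArg (Nat.cast (R := k[X])) (gap_add_two_mul_overlap j m l)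
  have derivative_pow : X * derivative (X ^ overlap j m l : k[X]) =
      (overlap j m l : k[X]) * X ^ overlap j m l := by
    rw [derivative_X_pow, map_natCast, mul_left_comm]
    obtain _ | e := overlap j m l
    · simp
    · rw [Nat.add_sub_cancel, pow_succ']
  simp only [qgrade_apply, mul, derivative_mul]
  linear_combination 2 * (g * f) * derivative_pow + X ^ overlap j m l * (g * f) * weight

variable (k n) in
/-- The derivations of `𝒞` with values in `k[s]`, on which `𝒞` acts through `embed`; they form a
module over `k[s]`. -/
noncomputable def derivations :
    Submodule k[X] (∀ _ _ : Fin (n + 1), k[X] →ₗ[k] k[X]) where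
  carrier := {D | ∀ j m l g f,
    D j l (mul j m l g f) = embed m l g * D j m f + D m l g * embed j m f}
  zero_mem' := by intro j m l g f; simp
  add_mem' := by
    intro D D' hD hD' j m l g f
    simp only [Pi.add_apply, LinearMap.add_apply, hD j m l g f, hD' j m l g f]
    ring
  smul_mem' := by
    intro p D hD j m l g f
    simp only [Pi.smul_apply, LinearMap.smul_apply, smul_eq_mul, hD j m l g f]
    ring

variable (k n) in
/-- The Euler derivation: the derivation `qgrade` of `𝒞`, followed by `embed`. -/
noncomputable def euler (j l : Fin (n + 1)) : k[X] →ₗ[k] k[X] :=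
  embed j l ∘ₗ qgrade j l

lemma euler_apply (j l : Fin (n + 1)) (f : k[X]) : euler k n j l f = embed j l (qgrade j l f) :=
  rfl

lemma euler_mem_derivations : euler k n ∈ derivations k n := by
  intro j m l g f
  rw [euler_apply, qgrade_mul, map_add, embed_mul, embed_mul, euler_apply, euler_apply]

lemma euler_self_X (j : Fin (n + 1)) : euler k n j j X = 2 * X := by
  rw [euler_apply, embed_self, qgrade_apply, derivative_X, gap, sub_self, Int.natAbs_zero]
  simp

variable {D : ∀ _ _ : Fin (n + 1), k[X] →ₗ[k] k[X]} (hD : D ∈ derivations k n)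
include hD

lemma derivation_one (j : Fin (n + 1)) : D j j 1 = 0 := by
  have h := hD j j j 1 1
  rw [mul_id_left, embed_self, mul_one, one_mul, mul_one] at h
  exact left_eq_add.1 h

lemma derivation_self_X (i j : Fin (n + 1)) : D j j X = D i i X := by
  have via_right := hD i j j X 1
  have via_left := hD i i j 1 X
  rw [mul_id_left, embed_self] at via_right
  rw [mul_id_right, embed_self] at via_left
  have h : embed i j 1 * D j j X = embed i j 1 * D i i X := by
    rw [mul_one] at via_right
    rw [one_mul] at via_left
    linear_combination via_left - via_right
  exact mul_left_cancel₀ (mul_ne_zero (pow_ne_zero _ X_ne_zero) one_ne_zero) h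

lemma derivation_eq_mul_one {i : Fin (n + 1)} (hX : D i i X = 0) (j l : Fin (n + 1)) (f : k[X]) :
    D j l f = f * D j l 1 := by
  induction f using Polynomial.induction_on with
  | C c => rw [← smul_eq_C_mul, ← map_smul, smul_eq_C_mul, mul_one]
  | add f g hf hg => rw [map_add, hf, hg, add_mul]
  | monomial e c ih =>
    have h := hD j l l X (C c * X ^ e)
    rw [mul_id_left, embed_self, derivation_self_X hD i l, hX, zero_mul, add_zero, ih] at h
    rw [show C c * X ^ (e + 1) = X * (C c * X ^ e) by ring, h]
    ring

/-- The potential is `w j = -D(a_{ji}) / a_{ji}`. -/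
lemma exists_potential {i : Fin (n + 1)} (hX : D i i X = 0) (hdvd : ∀ j, embed i j 1 ∣ D i j 1) :
    ∃ w : Fin (n + 1) → k[X], w i = 0 ∧ ∀ j l f, D j l f = embed j l f * (w j - w l) := by
  choose v hv using hdvd
  refine ⟨fun j => -v j, ?_, fun j l f => ?_⟩
  · have h := hv i
    rw [derivation_one hD, embed_self, one_mul] at h
    exact neg_eq_zero.2 h.symm
  · have path := hD i j l f 1
    rw [derivation_eq_mul_one hD hX, hv, hv] at path
    have functor := embed_mul i j l f (1 : k[X])
    rw [show embed i l (mul i j l f 1) = mul i j l f 1 * embed i l 1 by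
      rw [embed_apply, embed_apply]; ring] at functor
    have embed_one_ne_zero : embed i j (1 : k[X]) ≠ 0 :=
      mul_ne_zero (pow_ne_zero _ X_ne_zero) one_ne_zero
    refine mul_right_cancel₀ embed_one_ne_zero ?_
    linear_combination v l * functor - path

lemma exists_eq_smul_euler_add_inner (h2 : (2 : k) ≠ 0) {i : Fin (n + 1)} (hX : X ∣ D i i X)
    (hdvd : ∀ j, embed i j 1 ∣ D i j 1) :
    ∃ (p : k[X]) (w : Fin (n + 1) → k[X]), w i = 0 ∧
      ∀ j l f, D j l f = p * euler k n j l f + embed j l f * (w j - w l) := by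
  obtain ⟨c, hc⟩ := hX
  have half : (C (2⁻¹ : k) : k[X]) * 2 = 1 := by
    rw [← C_ofNat, ← C_mul, inv_mul_cancel₀ h2, C_1]
  have hD' : D - (C 2⁻¹ * c) • euler k n ∈ derivations k n :=
    sub_mem hD (Submodule.smul_mem _ _ euler_mem_derivations)
  have vanishes : (D - (C 2⁻¹ * c) • euler k n) i i X = 0 := by
    change D i i X - C 2⁻¹ * c * euler k n i i X = 0
    rw [euler_self_X, hc]
    linear_combination -(X * c) * half
  obtain ⟨w, hw, h⟩ := exists_potential hD' vanishes fun j => by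
    refine dvd_sub (hdvd j) (Dvd.dvd.mul_left ?_ _)
    change embed i j 1 ∣ embed i j (qgrade i j 1)
    rw [embed_apply, embed_apply, mul_one]
    exact dvd_mul_right _ _
  exact ⟨_, w, hw, fun j l f => eq_add_of_sub_eq' (h j l f)⟩

end Derivations

section Rows

variable {k : Type*} [Field k] {n : ℕ} {p : ℤ}

/-- The product of the row vector `w` on `Z` with the matrix `g : Y → Z`, where the entries of `w`
lie in `k[s]` and the morphisms of `𝒞` act on them through `embed`. -/
noncomputable def rowMul (Y Z : Tw k n) (w : ℕ → k[X]) (g : Mat k) : ℕ → k[X] := fun c =>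
  ∑ r ∈ Finset.range Z.len, w r * embed (Y.obj c) (Z.obj r) (g r c)

lemma rowMul_comp (W Y Z : Tw k n) (w : ℕ → k[X]) (g f : Mat k) :
    rowMul W Z w (comp W Y Z g f) = rowMul W Y (rowMul Y Z w g) f := by
  funext c
  simp only [rowMul, comp, map_sum, embed_mul, Finset.mul_sum, Finset.sum_mul]
  rw [Finset.sum_comm]
  simp only [mul_assoc]

lemma smul_rowMul (Y Z : Tw k n) (a : k[X]) (w : ℕ → k[X]) (g : Mat k) :
    rowMul Y Z (a • w) g = a • rowMul Y Z w g := by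
  funext c
  simp only [rowMul, Pi.smul_apply, smul_eq_mul, Finset.mul_sum, mul_assoc]

lemma zero_rowMul (Y Z : Tw k n) (g : Mat k) : rowMul Y Z 0 g = 0 := by
  funext c
  simp only [rowMul, Pi.zero_apply, zero_mul, Finset.sum_const_zero]

lemma AInfFunctor.eq_zero_of_mem_bimodule {G : AInfFunctor k n} {j l : Fin (n + 1)} {f : Mat k}
    (hf : f ∈ G.bimodule p j l)
    (h : ∀ r < (G.obj l).len, (G.obj l).deg r = p → f r 0 = 0) : f = 0 := by
  funext r c
  by_contra hne
  obtain ⟨hr, hc, hdeg⟩ := hf r c hne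
  obtain rfl : c = 0 := Nat.lt_one_iff.1 hc
  exact hne (h r hr ((sub_zero _).symm.trans hdeg))

end Rows

section Braid

variable {k : Type*} [Field k] {n : ℕ} (i : Fin (n + 1)) (h0 : 0 < (i : ℕ)) (h1 : (i : ℕ) < n)

/-- A closed row vector on each `β T_l`; on `β T_i = (T_i → T_{i-1} ⊕ T_{i+1})` it is
`(0, s, 1)`. -/
noncomputable def augRow (l : Fin (n + 1)) (r : ℕ) : k[X] :=
  if l = i then if r = 1 then X else if r = 2 then 1 else 0 else if r = 0 then 1 else 0

/-- The map `Hom^0(T_j, β T_l) → k[s]` given by `augRow`. Its kernel is the image of the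
differential, so that it embeds the cokernel into `k[s]`. -/
noncomputable def aug (j l : Fin (n + 1)) : Mat k →ₗ[k] k[X] where
  toFun f := rowMul (stalk k j) ((negBraid k i h0 h1).obj l) (augRow i l) f 0
  map_add' f g := by
    simp only [rowMul, Pi.add_apply, map_add, mul_add, Finset.sum_add_distrib]
  map_smul' c f := by
    simp only [rowMul, Pi.smul_apply, map_smul, mul_smul_comm, Finset.smul_sum, RingHom.id_apply]

lemma negBraid_obj_self : (negBraid k i h0 h1).obj i = braidObj k i h0 h1 := if_pos rfl

lemma negBraid_obj_of_ne {l : Fin (n + 1)} (hl : l ≠ i) :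
    (negBraid k i h0 h1).obj l = stalk k l := if_neg hl

lemma rowMul_augRow_of_ne {l : Fin (n + 1)} (hl : l ≠ i) (Y : Tw k n) (g : Mat k) (c : ℕ) :
    rowMul Y ((negBraid k i h0 h1).obj l) (augRow i l) g c = embed (Y.obj c) l (g 0 c) := by
  rw [negBraid_obj_of_ne i h0 h1 hl, rowMul, stalk_len, Finset.sum_range_one, augRow,
    if_neg hl, if_pos rfl, one_mul, stalk_obj]

lemma rowMul_augRow_self (Y : Tw k n) (g : Mat k) (c : ℕ) :
    rowMul Y ((negBraid k i h0 h1).obj i) (augRow i i) g c =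
      X * embed (Y.obj c) ⟨i - 1, by omega⟩ (g 1 c) +
        embed (Y.obj c) ⟨i + 1, by omega⟩ (g 2 c) := by
  rw [negBraid_obj_self, rowMul, braidObj_len]
  simp [Finset.sum_range_succ, augRow, braidObj_obj1, braidObj_obj2]

lemma rowMul_augRow_diff (l : Fin (n + 1)) :
    rowMul ((negBraid k i h0 h1).obj l) ((negBraid k i h0 h1).obj l) (augRow i l)
      ((negBraid k i h0 h1).obj l).diff = 0 := by
  funext c
  obtain rfl | hl := eq_or_ne l i
  · rw [rowMul_augRow_self, negBraid_obj_self, braidObj_diff]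
    obtain rfl | hc := eq_or_ne c 0
    · have lower : (l : ℕ) - 1 - l = 0 := by omega
      simp [braidObj_obj0, entry_apply, embed_apply, lower]
    · simp [entry_apply, hc]
  · rw [rowMul_augRow_of_ne i h0 h1 hl, negBraid_obj_of_ne i h0 h1 hl, stalk_diff]
    exact map_zero _

lemma rowMul_augRow_braid1_self (m : Fin (n + 1)) (g : k[X]) :
    rowMul ((negBraid k i h0 h1).obj m) ((negBraid k i h0 h1).obj i) (augRow i i)
      (braid1 i m i g) = embed m i g • augRow i m := by
  funext c
  rw [rowMul_augRow_self]
  obtain hm | rfl | hm := lt_trichotomy m i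
  · have exponent : (i : ℕ) - 1 - m + 1 = i - m := by omega
    rw [negBraid_obj_of_ne i h0 h1 hm.ne]
    obtain rfl | hc := eq_or_ne c 0 <;>
      simp [braid1, augRow, entry_apply, embed_apply, stalk_obj, hm.ne, hm.not_gt, X_nf6, *]
  · have cases : c = 0 ∨ c = 1 ∨ c = 2 ∨ 2 < c := by omega
    rw [negBraid_obj_self]
    obtain rfl | rfl | rfl | hc := cases <;>
      simp [braid1, augRow, entry_apply, embed_self, braidObj_obj1, braidObj_obj2] <;> grind
  · have exponent : (i : ℕ) + 1 - m = i - m := by omega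
    rw [negBraid_obj_of_ne i h0 h1 hm.ne']
    obtain rfl | hc := eq_or_ne c 0 <;>
      simp [braid1, augRow, entry_apply, embed_apply, stalk_obj, hm.ne', *]

lemma rowMul_augRow_braid1_of_ne (m : Fin (n + 1)) {l : Fin (n + 1)} (hl : l ≠ i) (g : k[X]) :
    rowMul ((negBraid k i h0 h1).obj m) ((negBraid k i h0 h1).obj l) (augRow i l)
      (braid1 i m l g) = embed m l g • augRow i m := by
  funext c
  rw [rowMul_augRow_of_ne i h0 h1 hl]
  obtain rfl | hm := eq_or_ne m i
  · have cases : c = 0 ∨ c = 1 ∨ c = 2 ∨ 2 < c := by omega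
    rw [negBraid_obj_self]
    obtain hl | hl := lt_or_gt_of_ne hl
    · have lower : (l : ℕ) - (m - 1) = 0 ∧ (l : ℕ) - m = 0 ∧ (l : ℕ) - (m + 1) = 0 := by omega
      obtain rfl | rfl | rfl | hc := cases <;>
        simp [braid1, augRow, entry_apply, embed_apply, braidObj_obj1, braidObj_obj2, hl.ne,
          hl.not_gt, lower] <;> grind
    · have upper : (l : ℕ) - (m - 1) = l - m + 1 ∧ (l : ℕ) - m = l - (m + 1) + 1 := by omega
      obtain rfl | rfl | rfl | hc := cases <;>
        simp [braid1, augRow, entry_apply, embed_apply, braidObj_obj1, braidObj_obj2, hl.ne',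
          hl, upper, pow_succ] <;> grind
  · rw [negBraid_obj_of_ne i h0 h1 hm]
    obtain rfl | hc := eq_or_ne c 0 <;> simp [braid1, augRow, entry_apply, stalk_obj, *]

lemma rowMul_augRow_braid1 (m l : Fin (n + 1)) (g : k[X]) :
    rowMul ((negBraid k i h0 h1).obj m) ((negBraid k i h0 h1).obj l) (augRow i l)
      (braid1 i m l g) = embed m l g • augRow i m := by
  obtain rfl | hl := eq_or_ne l i
  · exact rowMul_augRow_braid1_self l h0 h1 m g
  · exact rowMul_augRow_braid1_of_ne i h0 h1 m hl g

lemma aug_homDiff (j l : Fin (n + 1)) (f : Mat k) :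
    aug i h0 h1 j l ((negBraid k i h0 h1).homDiff j l f) = 0 := by
  change rowMul _ _ _ (comp _ _ _ _ f) 0 = 0
  rw [rowMul_comp, rowMul_augRow_diff, zero_rowMul, Pi.zero_apply]

lemma aug_postcomp (j m l : Fin (n + 1)) (g : k[X]) (f : Mat k) :
    aug i h0 h1 j l ((negBraid k i h0 h1).postcomp j m l g f) =
      embed m l g * aug i h0 h1 j m f := by
  change rowMul _ _ _ (comp _ _ _ (braid1 i m l g) f) 0 = _
  rw [rowMul_comp, rowMul_augRow_braid1, smul_rowMul]
  rfl

lemma aug_precomp (j m l : Fin (n + 1)) (g : Mat k) (f : k[X]) :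
    aug i h0 h1 j l ((negBraid k i h0 h1).precomp j m l g f) =
      aug i h0 h1 m l g * embed j m f := by
  change rowMul _ _ _ (comp _ _ _ g (entry 0 0 f)) 0 = _
  rw [rowMul_comp]
  exact Finset.sum_range_one _

lemma aug_leibniz (F : ∀ _ _ : Fin (n + 1), k[X] →ₗ[k] Mat k) (j m l : Fin (n + 1)) (g f : k[X]) :
    aug i h0 h1 j l ((negBraid k i h0 h1).leibniz F j m l g f) =
      embed m l g * aug i h0 h1 j m (F j m f) + aug i h0 h1 m l (F m l g) * embed j m f -
        aug i h0 h1 j l (F j l (mul j m l g f)) := by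
  rw [AInfFunctor.leibniz_apply, map_sub, map_add, aug_postcomp, aug_precomp]

lemma aug_innerDer (Z : Fin (n + 1) → Mat k) (j l : Fin (n + 1)) (f : k[X]) :
    aug i h0 h1 j l ((negBraid k i h0 h1).innerDer Z j l f) =
      embed j l f * (aug i h0 h1 j j (Z j) - aug i h0 h1 l l (Z l)) := by
  rw [AInfFunctor.innerDer_apply, map_sub, aug_postcomp, aug_precomp]
  ring

lemma aug_of_ne (j : Fin (n + 1)) {l : Fin (n + 1)} (hl : l ≠ i) (f : Mat k) :
    aug i h0 h1 j l f = embed j l (f 0 0) :=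
  rowMul_augRow_of_ne i h0 h1 hl _ f 0

lemma aug_self (j : Fin (n + 1)) (f : Mat k) :
    aug i h0 h1 j i f =
      X * embed j ⟨i - 1, by omega⟩ (f 1 0) + embed j ⟨i + 1, by omega⟩ (f 2 0) :=
  rowMul_augRow_self i h0 h1 _ f 0

lemma embed_one_dvd_aug (j : Fin (n + 1)) (f : Mat k) :
    embed i j 1 ∣ aug i h0 h1 i j f := by
  obtain rfl | hj := eq_or_ne j i
  · rw [embed_self]
    exact one_dvd _
  · rw [aug_of_ne i h0 h1 i hj, embed_apply, embed_apply, mul_one]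
    exact dvd_mul_right _ _

lemma X_dvd_aug_self (f : Mat k) : X ∣ aug i h0 h1 i i f := by
  rw [aug_self, embed_apply i ⟨i + 1, _⟩, Nat.add_sub_cancel_left, pow_one]
  exact dvd_add (dvd_mul_right _ _) (dvd_mul_right _ _)

/-- A contracting homotopy: a left inverse of the differential
`Hom^{-1}(T_j, β T_l) → Hom^0(T_j, β T_l)`. One of the two entries of the differential of `β T_i`
composes with `a_{ij}` without a factor `s`, and `retr` divides by this one. -/
noncomputable def retr (j l : Fin (n + 1)) : Mat k →ₗ[k] Mat k where
  toFun f := if l = i then entry 0 0 (if i < j then f 1 0 else -f 2 0) else 0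
  map_add' f g := by
    split_ifs <;> simp only [Pi.add_apply, ← entry_add, neg_add, add_zero]
  map_smul' c f := by
    split_ifs <;> simp only [Pi.smul_apply, ← entry_smul, smul_neg, RingHom.id_apply, smul_zero]

lemma retr_self (j : Fin (n + 1)) (f : Mat k) :
    retr i j i f = entry 0 0 (if i < j then f 1 0 else -f 2 0) := if_pos rfl

lemma retr_of_ne (j : Fin (n + 1)) {l : Fin (n + 1)} (hl : l ≠ i) (f : Mat k) :
    retr i j l f = 0 := if_neg hl

lemma retr_mem (j l : Fin (n + 1)) (f : Mat k) :
    retr i j l f ∈ (negBraid k i h0 h1).bimodule (-1) j l := by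
  obtain rfl | hl := eq_or_ne l i
  · rw [retr_self, AInfFunctor.bimodule, negBraid_obj_self]
    exact entry_mem _ (by decide : 0 < 3) Nat.one_pos rfl
  · rw [retr_of_ne i j hl]
    exact Submodule.zero_mem _

lemma retr_homDiff_self (j : Fin (n + 1)) (f : Mat k) :
    retr i j i ((negBraid k i h0 h1).homDiff j i f) = entry 0 0 (f 0 0) := by
  have differential : (negBraid k i h0 h1).homDiff j i f = comp (stalk k j) (braidObj k i h0 h1)
      (braidObj k i h0 h1) (braidObj k i h0 h1).diff f := by
    rw [← negBraid_obj_self]; rfl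
  rw [retr_self, differential]
  split_ifs with h
  · have : overlap j i ⟨i - 1, by omega⟩ = 0 := by rw [overlap_eq]; dsimp only; omega
    simp [comp, braidObj, entry_apply, mul, stalk_obj, this]
  · have : overlap j i ⟨i + 1, by omega⟩ = 0 := by rw [overlap_eq]; dsimp only; omega
    simp [comp, braidObj, entry_apply, mul, stalk_obj, this]

lemma negBraid_bimodule_eq_zero {p : ℤ} {j l : Fin (n + 1)} {f : Mat k}
    (hf : f ∈ (negBraid k i h0 h1).bimodule p j l) (hp : p ≠ 0) (h : l = i → p ≠ -1) : f = 0 := by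
  refine AInfFunctor.eq_zero_of_mem_bimodule hf fun r _ hr => ?_
  obtain rfl | hl := eq_or_ne l i
  · rw [negBraid_obj_self] at hr
    simp only [braidObj] at hr
    split_ifs at hr
    · exact absurd hr.symm (h rfl)
    · exact absurd hr.symm hp
  · rw [negBraid_obj_of_ne i h0 h1 hl] at hr
    exact absurd hr.symm hp

lemma retr_homDiff {j l : Fin (n + 1)} {f : Mat k}
    (hf : f ∈ (negBraid k i h0 h1).bimodule (-1) j l) :
    retr i j l ((negBraid k i h0 h1).homDiff j l f) = f := by
  obtain rfl | hl := eq_or_ne l i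
  · rw [retr_homDiff_self]
    have hentry : entry 0 0 (f 0 0) ∈ (negBraid k l h0 h1).bimodule (-1) j l := by
      rw [← retr_homDiff_self l h0 h1]
      exact retr_mem l h0 h1 j l _
    refine sub_eq_zero.1 (AInfFunctor.eq_zero_of_mem_bimodule (sub_mem hentry hf) fun r _ hr => ?_)
    rw [negBraid_obj_self] at hr
    obtain rfl : r = 0 := by simpa [braidObj] using hr
    simp [entry_apply]
  · rw [retr_of_ne i j hl]
    exact (negBraid_bimodule_eq_zero i h0 h1 hf (by decide) fun h => absurd h hl).symm

lemma eq_zero_of_aug_of_retr {j l : Fin (n + 1)} {f : Mat k}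
    (hf : f ∈ (negBraid k i h0 h1).bimodule 0 j l) (haug : aug i h0 h1 j l f = 0)
    (hretr : retr i j l f = 0) : f = 0 := by
  obtain rfl | hl := eq_or_ne l i
  · rw [aug_self] at haug
    rw [retr_self] at hretr
    have hentry : (if l < j then f 1 0 else -f 2 0) = 0 := congrFun₂ hretr 0 0
    have entries : f 1 0 = 0 ∧ f 2 0 = 0 := by
      split_ifs at hentry
      · rw [hentry, map_zero, mul_zero, zero_add] at haug
        exact ⟨hentry, embed_injective _ _ (haug.trans (map_zero _).symm)⟩
      · rw [neg_eq_zero] at hentry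
        rw [hentry, map_zero, add_zero, mul_eq_zero, or_iff_right X_ne_zero] at haug
        exact ⟨embed_injective _ _ (haug.trans (map_zero _).symm), hentry⟩
    refine AInfFunctor.eq_zero_of_mem_bimodule hf fun r hr hdeg => ?_
    rw [negBraid_obj_self] at hr hdeg
    obtain rfl | rfl | rfl : r = 0 ∨ r = 1 ∨ r = 2 := by rw [braidObj_len] at hr; omega
    · simp [braidObj] at hdeg
    · exact entries.1
    · exact entries.2
  · rw [aug_of_ne i h0 h1 j hl] at haug
    refine AInfFunctor.eq_zero_of_mem_bimodule hf fun r hr _ => ?_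
    rw [negBraid_obj_of_ne i h0 h1 hl, stalk_len, Nat.lt_one_iff] at hr
    rw [hr]
    exact embed_injective j l (haug.trans (map_zero _).symm)

lemma homDiff_retr {j l : Fin (n + 1)} {f : Mat k}
    (hf : f ∈ (negBraid k i h0 h1).bimodule 0 j l) (haug : aug i h0 h1 j l f = 0) :
    (negBraid k i h0 h1).homDiff j l (retr i j l f) = f := by
  have hretr := retr_mem i h0 h1 j l f
  refine sub_eq_zero.1 (eq_zero_of_aug_of_retr i h0 h1 (sub_mem ?_ hf) ?_ ?_)
  · exact AInfFunctor.homDiff_mem hretr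
  · rw [map_sub, aug_homDiff, haug, sub_zero]
  · rw [map_sub, retr_homDiff i h0 h1 hretr, sub_self]

lemma negBraid_isTwoTerm : (negBraid k i h0 h1).IsTwoTerm where
  eq_zero hf hp hp' := negBraid_bimodule_eq_zero i h0 h1 hf hp fun _ => hp'
  injective hf hf' h := by rw [← retr_homDiff i h0 h1 hf, h, retr_homDiff i h0 h1 hf']

end Braid

section Transformations

variable {k : Type*} [Field k] {n : ℕ} (i : Fin (n + 1))

lemma divX_smul (c : k) (f : k[X]) : divX (c • f) = c • divX f := by
  rw [smul_eq_C_mul, divX_C_mul, smul_eq_C_mul]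

lemma divX_X_mul (f : k[X]) : divX (X * f) = f := by
  ext e
  rw [coeff_divX, coeff_X_mul]

/-- A lift of `f ∈ Hom(T_j, T_l) = k[s]` to `Hom^0(T_j, β T_l)` along `aug`. For `j = l = i` it
lifts `f` only if `f` is divisible by `s`. -/
noncomputable def augLift (j l : Fin (n + 1)) : k[X] →ₗ[k] Mat k where
  toFun f :=
    if l ≠ i then entry 0 0 f
    else if j < i then entry 1 0 f
    else if i < j then entry 2 0 f
    else entry 1 0 ((2⁻¹ : k) • divX f) + entry 2 0 ((2⁻¹ : k) • divX f)
  map_add' f g := by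
    split_ifs <;> simp only [divX_add, smul_add, entry_add]
    abel
  map_smul' c f := by
    split_ifs <;> simp only [divX_smul, smul_comm _ c, entry_smul, smul_add,
      RingHom.id_apply]

lemma augLift_of_ne (j : Fin (n + 1)) {l : Fin (n + 1)} (hl : l ≠ i) (f : k[X]) :
    augLift i j l f = entry 0 0 f := if_pos hl

lemma augLift_of_lt {j : Fin (n + 1)} (hj : j < i) (f : k[X]) :
    augLift i j i f = entry 1 0 f := by
  simp [augLift, hj]

lemma augLift_of_gt {j : Fin (n + 1)} (hj : i < j) (f : k[X]) :
    augLift i j i f = entry 2 0 f := by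
  simp [augLift, hj, hj.not_gt]

lemma augLift_self (f : k[X]) :
    augLift i i i f = entry 1 0 ((2⁻¹ : k) • divX f) + entry 2 0 ((2⁻¹ : k) • divX f) := by
  simp [augLift]

variable (h0 : 0 < (i : ℕ)) (h1 : (i : ℕ) < n)

lemma augLift_mem (j l : Fin (n + 1)) (f : k[X]) :
    augLift i j l f ∈ (negBraid k i h0 h1).bimodule 0 j l := by
  obtain rfl | hl := eq_or_ne l i
  · rw [AInfFunctor.bimodule, negBraid_obj_self]
    have row_one (f : k[X]) : entry 1 0 f ∈ TwHom 0 (stalk k j) (braidObj k l h0 h1) :=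
      entry_mem _ (by decide : 1 < 3) Nat.one_pos rfl
    have row_two (f : k[X]) : entry 2 0 f ∈ TwHom 0 (stalk k j) (braidObj k l h0 h1) :=
      entry_mem _ (by decide : 2 < 3) Nat.one_pos rfl
    obtain hj | rfl | hj := lt_trichotomy j l
    · exact augLift_of_lt l hj f ▸ row_one f
    · exact augLift_self j f ▸ add_mem (row_one _) (row_two _)
    · exact augLift_of_gt l hj f ▸ row_two f
  · rw [augLift_of_ne i j hl, AInfFunctor.bimodule, negBraid_obj_of_ne i h0 h1 hl]
    exact entry_mem _ Nat.one_pos Nat.one_pos rfl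

lemma aug_augLift (h2 : (2 : k) ≠ 0) (j l : Fin (n + 1)) {f : k[X]}
    (hf : j = i → l = i → X ∣ f) : aug i h0 h1 j l (augLift i j l f) = embed j l f := by
  obtain rfl | hl := eq_or_ne l i
  · rw [aug_self]
    obtain hj | rfl | hj := lt_trichotomy j l
    · have exponent : (l : ℕ) - j = l - 1 - j + 1 := by omega
      rw [augLift_of_lt l hj]
      simp [entry_apply, embed_apply, exponent, X_nf6]
    · obtain ⟨f, rfl⟩ := hf rfl rfl
      have lower : (j : ℕ) - 1 - j = 0 := by omega
      rw [augLift_self]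
      have halves : (2⁻¹ : k) • (X * f) + (2⁻¹ : k) • (X * f) = X * f := by
        rw [← two_smul k, smul_inv_smul₀ h2]
      simp [entry_apply, embed_apply, lower, divX_X_mul, halves]
    · have exponents : (l : ℕ) - j = 0 ∧ (l : ℕ) + 1 - j = 0 := by omega
      rw [augLift_of_gt l hj]
      simp [entry_apply, embed_apply, exponents]
  · rw [aug_of_ne i h0 h1 j hl, augLift_of_ne i j hl]
    simp [entry_apply]

/-- The first component of the natural transformation attached to `p ∈ k[s]`: the lift of `p` times
the Euler derivation. -/
noncomputable def etaOne (p : k[X]) (j l : Fin (n + 1)) : k[X] →ₗ[k] Mat k :=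
  augLift i j l ∘ₗ LinearMap.mulLeft k p ∘ₗ qgrade j l

lemma etaOne_apply (p : k[X]) (j l : Fin (n + 1)) (f : k[X]) :
    etaOne i p j l f = augLift i j l (p * qgrade j l f) := rfl

lemma etaOne_add (p q : k[X]) (j l : Fin (n + 1)) :
    etaOne i (p + q) j l = etaOne i p j l + etaOne i q j l := by
  refine LinearMap.ext fun f => ?_
  simp only [etaOne_apply, add_mul, map_add, LinearMap.add_apply]

lemma etaOne_smul (c : k) (p : k[X]) (j l : Fin (n + 1)) :
    etaOne i (c • p) j l = c • etaOne i p j l := by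
  refine LinearMap.ext fun f => ?_
  simp only [etaOne_apply, smul_mul_assoc, map_smul, LinearMap.smul_apply]

lemma X_dvd_qgrade_self (f : k[X]) : X ∣ qgrade i i f := by
  rw [qgrade_apply, gap, sub_self, Int.natAbs_zero, Nat.cast_zero, zero_mul, add_zero]
  exact dvd_mul_of_dvd_right (dvd_mul_right _ _) _

lemma etaOne_mem (p : k[X]) (j l : Fin (n + 1)) (f : k[X]) :
    etaOne i p j l f ∈ (negBraid k i h0 h1).bimodule 0 j l :=
  augLift_mem i h0 h1 j l _

lemma aug_etaOne (h2 : (2 : k) ≠ 0) (p : k[X]) (j l : Fin (n + 1)) (f : k[X]) :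
    aug i h0 h1 j l (etaOne i p j l f) = p * euler k n j l f := by
  rw [etaOne_apply, aug_augLift i h0 h1 h2, euler_apply, embed_apply, embed_apply, mul_left_comm]
  rintro rfl rfl
  exact dvd_mul_of_dvd_right (X_dvd_qgrade_self _ f) p

lemma aug_leibniz_etaOne (h2 : (2 : k) ≠ 0) (p : k[X]) (j m l : Fin (n + 1)) (g f : k[X]) :
    aug i h0 h1 j l ((negBraid k i h0 h1).leibniz (etaOne i p) j m l g f) = 0 := by
  simp only [aug_leibniz, aug_etaOne i h0 h1 h2, euler_mem_derivations j m l g f]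
  ring

/-- The second component of the natural transformation attached to `p ∈ k[s]`: the solution of
`μ¹(η²) = leibniz` given by `retr`. -/
noncomputable def etaTwo (p : k[X]) (j m l : Fin (n + 1)) : k[X] →ₗ[k] k[X] →ₗ[k] Mat k :=
  ((negBraid k i h0 h1).leibniz (etaOne i p) j m l).compr₂ (retr i j l)

lemma etaTwo_apply (p : k[X]) (j m l : Fin (n + 1)) (g f : k[X]) : etaTwo i h0 h1 p j m l g f =
    retr i j l ((negBraid k i h0 h1).leibniz (etaOne i p) j m l g f) := rfl

lemma etaTwo_add (p q : k[X]) (j m l : Fin (n + 1)) :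
    etaTwo i h0 h1 (p + q) j m l = etaTwo i h0 h1 p j m l + etaTwo i h0 h1 q j m l := by
  refine LinearMap.ext₂ fun g f => ?_
  simp only [LinearMap.add_apply, etaTwo_apply, AInfFunctor.leibniz_apply, etaOne_add, map_add,
    map_sub]
  abel

lemma etaTwo_smul (c : k) (p : k[X]) (j m l : Fin (n + 1)) :
    etaTwo i h0 h1 (c • p) j m l = c • etaTwo i h0 h1 p j m l := by
  refine LinearMap.ext₂ fun g f => ?_
  simp only [LinearMap.smul_apply, etaTwo_apply, AInfFunctor.leibniz_apply, etaOne_smul, map_smul,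
    map_sub, map_add, smul_sub, smul_add]

lemma homDiff_etaTwo (h2 : (2 : k) ≠ 0) (p : k[X]) (j m l : Fin (n + 1)) (g f : k[X]) :
    (negBraid k i h0 h1).homDiff j l (etaTwo i h0 h1 p j m l g f) =
      (negBraid k i h0 h1).leibniz (etaOne i p) j m l g f :=
  homDiff_retr i h0 h1
    (AInfFunctor.leibniz_mem (etaOne_mem i h0 h1 p) j m l g f)
    (aug_leibniz_etaOne i h0 h1 h2 p j m l g f)

/-- The natural transformation attached to `p ∈ k[s]`. -/
noncomputable def eta (h2 : (2 : k) ≠ 0) :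
    k[X] →ₗ[k] NatTrans (incl k n) (negBraid k i h0 h1) 1 where
  toFun p := ⟨fam 0 (etaOne i p) (etaTwo i h0 h1 p),
    ((negBraid_isTwoTerm i h0 h1).fam_mem_natTrans_iff (etaOne_mem i h0 h1 p)
      fun j m l g f => retr_mem i h0 h1 j l _).2 (homDiff_etaTwo i h0 h1 h2 p)⟩
  map_add' p q := by
    refine Subtype.ext (funext fun d => funext fun x => funext fun a => ?_)
    match d with
    | 0 => exact (add_zero 0).symm
    | 1 => exact LinearMap.congr_fun (etaOne_add i p q (x 0) (x 1)) (a 0)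
    | 2 => exact LinearMap.congr_fun₂ (etaTwo_add i h0 h1 p q (x 0) (x 1) (x 2)) (a 1) (a 0)
    | _ + 3 => exact (add_zero 0).symm
  map_smul' c p := by
    refine Subtype.ext (funext fun d => funext fun x => funext fun a => ?_)
    match d with
    | 0 => exact (smul_zero c).symm
    | 1 => exact LinearMap.congr_fun (etaOne_smul i c p (x 0) (x 1)) (a 0)
    | 2 => exact LinearMap.congr_fun₂ (etaTwo_smul i h0 h1 c p (x 0) (x 1) (x 2)) (a 1) (a 0)
    | _ + 3 => exact (smul_zero c).symm

end Transformations

section Classification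

variable {k : Type*} [Field k] {n : ℕ} (i : Fin (n + 1)) (h0 : 0 < (i : ℕ)) (h1 : (i : ℕ) < n)

lemma exists_aug_eq_smul_euler_add_inner (h2 : (2 : k) ≠ 0)
    (θ : NatTrans (incl k n) (negBraid k i h0 h1) 1) :
    ∃ (p : k[X]) (w : Fin (n + 1) → k[X]), w i = 0 ∧ ∀ j l f,
      aug i h0 h1 j l (θ.1 1 ![j, l] ![f]) = p * euler k n j l f + embed j l f * (w j - w l) := by
  obtain ⟨F1, F2, -, -, hcocycle, hθ⟩ :=
    (negBraid_isTwoTerm i h0 h1).exists_eq_fam_of_mem_natTrans θ.2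
  have derivation : (fun j l => aug i h0 h1 j l ∘ₗ F1 j l) ∈ derivations k n := by
    intro j m l g f
    have h := aug_leibniz i h0 h1 F1 j m l g f
    rw [← hcocycle, aug_homDiff] at h
    exact (sub_eq_zero.1 h.symm).symm
  obtain ⟨p, w, hw, hD⟩ := exists_eq_smul_euler_add_inner derivation h2
    (X_dvd_aug_self i h0 h1 _) fun j => embed_one_dvd_aug i h0 h1 j _
  exact ⟨p, w, hw, fun j l f => by rw [hθ]; exact hD j l f⟩

lemma exists_aug_eq {w : Fin (n + 1) → k[X]} (hw : w i = 0) :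
    ∃ Z : Fin (n + 1) → Mat k, (∀ j, Z j ∈ (negBraid k i h0 h1).bimodule 0 j j) ∧
      ∀ j, aug i h0 h1 j j (Z j) = w j := by
  refine ⟨fun j => if j = i then 0 else entry 0 0 (w j), fun j => ?_, fun j => ?_⟩
  · dsimp only
    split_ifs with hj
    · exact Submodule.zero_mem _
    · rw [AInfFunctor.bimodule, negBraid_obj_of_ne i h0 h1 hj]
      exact entry_mem _ Nat.one_pos Nat.one_pos rfl
  · dsimp only
    split_ifs with hj
    · rw [LinearMap.map_zero, hj, hw]
    · rw [aug_of_ne i h0 h1 j hj, embed_self, entry_apply, if_pos ⟨rfl, rfl⟩]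

lemma mem_coboundaries_of_aug_eq (θ : NatTrans (incl k n) (negBraid k i h0 h1) 1)
    {w : Fin (n + 1) → k[X]} (hw : w i = 0)
    (hθ : ∀ j l f, aug i h0 h1 j l (θ.1 1 ![j, l] ![f]) = embed j l f * (w j - w l)) :
    θ ∈ coboundaries (incl k n) (negBraid k i h0 h1) 1 := by
  obtain ⟨F1, F2, hF1, hF2, hcocycle, hfam⟩ :=
    (negBraid_isTwoTerm i h0 h1).exists_eq_fam_of_mem_natTrans θ.2
  obtain ⟨Z0, hZ0, haug⟩ := exists_aug_eq i h0 h1 hw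
  let Z1 j l := retr i j l ∘ₗ ((negBraid k i h0 h1).innerDer Z0 j l - F1 j l)
  have hZ1 (j l : Fin (n + 1)) (f : k[X]) : Z1 j l f ∈ (negBraid k i h0 h1).bimodule (-1) j l :=
    retr_mem i h0 h1 j l _
  have hFZ (j l : Fin (n + 1)) (f : k[X]) : F1 j l f =
      (negBraid k i h0 h1).innerDer Z0 j l f - (negBraid k i h0 h1).homDiff j l (Z1 j l f) := by
    have haug_F1 : aug i h0 h1 j l (F1 j l f) = embed j l f * (w j - w l) := by
      rw [← hθ, hfam]; rfl
    refine (sub_eq_iff_eq_add.2 (sub_eq_iff_eq_add'.1 (homDiff_retr i h0 h1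
      (sub_mem (AInfFunctor.innerDer_mem hZ0 j l f) (hF1 j l f)) ?_).symm)).symm
    rw [map_sub, aug_innerDer, haug, haug, haug_F1, sub_self]
  refine ⟨fam Z0 Z1 0, AInfFunctor.fam_mem_preNat hZ0 hZ1 fun _ _ _ _ _ => Submodule.zero_mem _, ?_⟩
  exact ((negBraid_isTwoTerm i h0 h1).natDiff_fam_zero_eq hF2 hcocycle hZ0 hZ1 hFZ).trans hfam.symm

lemma mkQ_eta_surjective (h2 : (2 : k) ≠ 0) : Function.Surjective
    ((coboundaries (incl k n) (negBraid k i h0 h1) 1).mkQ ∘ₗ eta i h0 h1 h2) := by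
  intro q
  obtain ⟨θ, rfl⟩ := Submodule.mkQ_surjective _ q
  obtain ⟨p, w, hw, hθ⟩ := exists_aug_eq_smul_euler_add_inner i h0 h1 h2 θ
  refine ⟨p, ((Submodule.Quotient.eq _).2 (mem_coboundaries_of_aug_eq i h0 h1 (θ - eta i h0 h1 h2 p)
    hw fun j l f => ?_)).symm⟩
  change aug i h0 h1 j l (θ.1 1 ![j, l] ![f] - etaOne i p j l f) = _
  rw [map_sub, hθ, aug_etaOne i h0 h1 h2, add_sub_cancel_left]

lemma eq_zero_of_eta_mem_coboundaries (h2 : (2 : k) ≠ 0) {p : k[X]}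
    (hp : eta i h0 h1 h2 p ∈ coboundaries (incl k n) (negBraid k i h0 h1) 1) : p = 0 := by
  obtain ⟨ζ, hζ, h⟩ := hp
  obtain ⟨Z0, Z1, -, -, rfl⟩ := (negBraid_isTwoTerm i h0 h1).exists_eq_fam_zero hζ
  have component_one := congrFun₂ (congrFun h 1) ![i, i] ![X]
  have haug : p * euler k n i i X = 0 := by
    rw [← aug_etaOne i h0 h1 h2]
    refine (congrArg (aug i h0 h1 i i) (component_one.symm.trans
      (AInfFunctor.natDiff_fam_zero_one _ _))).trans ?_
    exact (by rw [map_sub, aug_innerDer, aug_homDiff, sub_self, mul_zero, sub_zero] :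
      aug i h0 h1 i i (AInfFunctor.innerDer _ Z0 i i X - AInfFunctor.homDiff _ i i (Z1 i i X)) = 0)
  rw [euler_self_X] at haug
  exact (mul_eq_zero.1 haug).resolve_right
    (mul_ne_zero (by exact_mod_cast C_ne_zero.2 h2) X_ne_zero)

lemma mkQ_eta_injective (h2 : (2 : k) ≠ 0) : Function.Injective
    ((coboundaries (incl k n) (negBraid k i h0 h1) 1).mkQ ∘ₗ eta i h0 h1 h2) :=
  (injective_iff_map_eq_zero _).2 fun _ hp =>
    eq_zero_of_eta_mem_coboundaries i h0 h1 h2 ((Submodule.Quotient.mk_eq_zero _).1 hp)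

end Classification

section Formulas

variable {k : Type*} [Field k] {n : ℕ} (i : Fin (n + 1)) (h0 : 0 < (i : ℕ)) (h1 : (i : ℕ) < n)

lemma postcomp_entry_of_lt (j : Fin (n + 1)) {m : Fin (n + 1)} (hm : m < i) (g f : k[X]) :
    (negBraid k i h0 h1).postcomp j m i g (entry 0 0 f) =
      entry 1 0 (mul j m ⟨i - 1, by omega⟩ g f) := by
  change comp _ ((negBraid k i h0 h1).obj m) ((negBraid k i h0 h1).obj i) (braid1 i m i g) _ = _
  rw [negBraid_obj_of_ne i h0 h1 hm.ne, negBraid_obj_self, braid1, if_neg hm.ne, if_pos rfl,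
    if_neg hm.not_gt, comp_entry, if_pos ⟨rfl, Nat.one_pos⟩]
  rfl

lemma postcomp_entry_of_gt (j : Fin (n + 1)) {m : Fin (n + 1)} (hm : i < m) (g f : k[X]) :
    (negBraid k i h0 h1).postcomp j m i g (entry 0 0 f) =
      entry 2 0 (mul j m ⟨i + 1, by omega⟩ g f) := by
  change comp _ ((negBraid k i h0 h1).obj m) ((negBraid k i h0 h1).obj i) (braid1 i m i g) _ = _
  rw [negBraid_obj_of_ne i h0 h1 hm.ne', negBraid_obj_self, braid1, if_neg hm.ne', if_pos rfl,
    if_pos hm, comp_entry, if_pos ⟨rfl, Nat.one_pos⟩]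
  rfl

lemma precomp_entry_one (j m : Fin (n + 1)) (g f : k[X]) :
    (negBraid k i h0 h1).precomp j m i (entry 1 0 g) f =
      entry 1 0 (mul j m ⟨i - 1, by omega⟩ g f) := by
  change comp _ _ ((negBraid k i h0 h1).obj i) _ (entry 0 0 f) = _
  rw [negBraid_obj_self, comp_entry, if_pos ⟨rfl, Nat.one_pos⟩]
  rfl

lemma precomp_entry_two (j m : Fin (n + 1)) (g f : k[X]) :
    (negBraid k i h0 h1).precomp j m i (entry 2 0 g) f =
      entry 2 0 (mul j m ⟨i + 1, by omega⟩ g f) := by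
  change comp _ _ ((negBraid k i h0 h1).obj i) _ (entry 0 0 f) = _
  rw [negBraid_obj_self, comp_entry, if_pos ⟨rfl, Nat.one_pos⟩]
  rfl

lemma postcomp_self_entry_one (j : Fin (n + 1)) (g f : k[X]) :
    (negBraid k i h0 h1).postcomp j i i g (entry 1 0 f) = entry 1 0 (g * f) := by
  change comp _ ((negBraid k i h0 h1).obj i) ((negBraid k i h0 h1).obj i) (braid1 i i i g) _ = _
  rw [negBraid_obj_self, braid1, if_pos rfl, if_pos rfl]
  simp [add_comp, comp_entry, braidObj_len, mul_id_left]

lemma postcomp_self_entry_two (j : Fin (n + 1)) (g f : k[X]) :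
    (negBraid k i h0 h1).postcomp j i i g (entry 2 0 f) = entry 2 0 (g * f) := by
  change comp _ ((negBraid k i h0 h1).obj i) ((negBraid k i h0 h1).obj i) (braid1 i i i g) _ = _
  rw [negBraid_obj_self, braid1, if_pos rfl, if_pos rfl]
  simp [add_comp, comp_entry, braidObj_len, mul_id_left]

variable (p : k[X]) {j m : Fin (n + 1)} (g f : k[X])

lemma mul_smul_qgrade_add {l l' : Fin (n + 1)} (h : overlap j m l = overlap j m l' + 1) :
    mul j m l' g (p * qgrade j m f) + mul j m l' (p * qgrade m l g) f =
      divX (p * qgrade j l (mul j m l g f)) := by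
  rw [← divX_X_mul (_ + _), qgrade_mul, mul, mul, mul, mul, h, pow_succ]
  ring_nf

lemma leibniz_etaOne_of_lt (hm : m < i) :
    (negBraid k i h0 h1).leibniz (etaOne i p) j m i g f =
      entry 1 0 (mul j m ⟨i - 1, by omega⟩ g (p * qgrade j m f) +
          mul j m ⟨i - 1, by omega⟩ (p * qgrade m i g) f) -
        augLift i j i (p * qgrade j i (mul j m i g f)) := by
  rw [AInfFunctor.leibniz_apply, etaOne_apply, etaOne_apply, etaOne_apply, augLift_of_ne i j hm.ne,
    augLift_of_lt i hm, postcomp_entry_of_lt i h0 h1 j hm, precomp_entry_one, ← entry_add]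

lemma leibniz_etaOne_of_gt (hm : i < m) :
    (negBraid k i h0 h1).leibniz (etaOne i p) j m i g f =
      entry 2 0 (mul j m ⟨i + 1, by omega⟩ g (p * qgrade j m f) +
          mul j m ⟨i + 1, by omega⟩ (p * qgrade m i g) f) -
        augLift i j i (p * qgrade j i (mul j m i g f)) := by
  rw [AInfFunctor.leibniz_apply, etaOne_apply, etaOne_apply, etaOne_apply, augLift_of_ne i j hm.ne',
    augLift_of_gt i hm, postcomp_entry_of_gt i h0 h1 j hm, precomp_entry_two, ← entry_add]

lemma etaTwo_of_lt (hm : m < i) :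
    etaTwo i h0 h1 p j m i g f =
      entry 0 0 ((if i < j then 1 else if j = i then 2⁻¹ else 0 : k) •
        divX (p * qgrade j i (mul j m i g f))) := by
  rw [etaTwo_apply, leibniz_etaOne_of_lt i h0 h1 p g f hm, retr_self]
  obtain hj | rfl | hj := lt_trichotomy j i
  · simp [augLift_of_lt i hj, hj.not_gt, hj.ne, entry_apply]
  · simp [augLift_self, entry_apply]
  · have shift : overlap j m i = overlap j m ⟨i - 1, by omega⟩ + 1 := by
      rw [overlap_eq, overlap_eq]; dsimp only; omega
    rw [mul_smul_qgrade_add p g f shift, augLift_of_gt i hj]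
    simp [hj, entry_apply]

lemma etaTwo_of_gt (h2 : (2 : k) ≠ 0) (hm : i < m) :
    etaTwo i h0 h1 p j m i g f =
      entry 0 0 (-(if j < i then 1 else if j = i then 2⁻¹ else 0 : k) •
        divX (p * qgrade j i (mul j m i g f))) := by
  rw [etaTwo_apply, leibniz_etaOne_of_gt i h0 h1 p g f hm, retr_self]
  obtain hj | hj := lt_or_ge i j
  · simp [augLift_of_gt i hj, hj, hj.not_gt, hj.ne', entry_apply]
  · have shift : overlap j m i = overlap j m ⟨i + 1, by omega⟩ + 1 := by
      rw [overlap_eq, overlap_eq]; dsimp only; omega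
    rw [mul_smul_qgrade_add p g f shift]
    obtain hj | rfl := hj.lt_or_eq
    · simp [augLift_of_lt i hj, hj, hj.not_gt, entry_apply]
    · have half : (1 : k) - 2⁻¹ = 2⁻¹ := by field_simp; norm_num
      rw [augLift_self, if_neg (lt_irrefl j), if_neg (lt_irrefl j), if_pos rfl]
      nth_rw 3 [← half]
      simp [entry_apply, sub_smul]

lemma etaTwo_mid_self : etaTwo i h0 h1 p i i i g f = 0 := by
  obtain ⟨a, ha⟩ := X_dvd_qgrade_self i f
  obtain ⟨b, hb⟩ := X_dvd_qgrade_self i g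
  have overlap_zero : overlap i i ⟨i + 1, by omega⟩ = 0 := by rw [overlap_eq]; dsimp only; omega
  have factor : p * (g * (X * a)) + p * (X * b * f) = X * (p * (g * a + b * f)) := by ring
  rw [etaTwo_apply, AInfFunctor.leibniz_apply, etaOne_apply, etaOne_apply, etaOne_apply, qgrade_mul,
    mul_id_left, mul_id_left, ha, hb, mul_add, factor, mul_left_comm p, mul_left_comm p,
    augLift_self, augLift_self, augLift_self, divX_X_mul, divX_X_mul, divX_X_mul, map_add,
    LinearMap.map_add₂, postcomp_self_entry_one, postcomp_self_entry_two, precomp_entry_one,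
    precomp_entry_two, retr_self, if_neg (lt_irrefl i), mul, mul, overlap_zero]
  have cancel : (2⁻¹ : k) • (p * (g * a + b * f)) -
      ((2⁻¹ : k) • (g * (p * a)) + (2⁻¹ : k) • (p * b * f)) = 0 := by
    simp only [smul_eq_C_mul]; ring
  rw [← entry_zero 0 0, ← cancel]
  simp [entry_apply]

lemma etaTwo_mid :
    etaTwo i h0 h1 p j i i g f =
      entry 0 0 (((sgn j i : k) * 2⁻¹) • (divX (p * qgrade i i g) * f)) := by
  obtain hj | rfl | hj := lt_trichotomy j i
  · have overlap_zero : overlap j i ⟨i + 1, by omega⟩ = 0 := by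
      rw [overlap_eq]; dsimp only; omega
    have sign : sgn j i = -1 := Int.sign_eq_neg_one_of_neg (by omega)
    rw [etaTwo_apply, AInfFunctor.leibniz_apply, etaOne_apply, etaOne_apply, etaOne_apply,
      augLift_self, augLift_of_lt i hj, augLift_of_lt i hj, LinearMap.map_add₂,
      postcomp_self_entry_one, precomp_entry_one, precomp_entry_two, retr_self, mul, mul,
      overlap_zero, sign]
    simp [hj.not_gt, entry_apply]
  · rw [etaTwo_mid_self, sgn, sub_self, Int.sign_zero, Int.cast_zero, zero_mul, zero_smul,
      entry_zero]
  · have overlap_zero : overlap j i ⟨i - 1, by omega⟩ = 0 := by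
      rw [overlap_eq]; dsimp only; omega
    have sign : sgn j i = 1 := Int.sign_eq_one_of_pos (by omega)
    rw [etaTwo_apply, AInfFunctor.leibniz_apply, etaOne_apply, etaOne_apply, etaOne_apply,
      augLift_self, augLift_of_gt i hj, augLift_of_gt i hj, LinearMap.map_add₂,
      postcomp_self_entry_two, precomp_entry_one, precomp_entry_two, retr_self, mul, mul,
      overlap_zero, sign]
    simp [hj, entry_apply]

end Formulas

section HalfSums

variable {k : Type*} [Field k] {n : ℕ}

/-- `σ ↦ ∑_ℓ (1/2) σ_ℓ s^ℓ`. -/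
noncomputable def halfPoly (k : Type*) [Field k] : (ℕ →₀ k) →ₗ[k] k[X] :=
  Finsupp.lsum k fun ℓ => (2⁻¹ : k) • monomial ℓ

lemma halfPoly_apply (σ : ℕ →₀ k) : halfPoly k σ = σ.sum fun ℓ c => C (2⁻¹ * c) * X ^ ℓ := by
  rw [halfPoly, Finsupp.lsum_apply]
  congr 1
  funext ℓ c
  rw [LinearMap.smul_apply, smul_monomial, smul_eq_mul, C_mul_X_pow_eq_monomial]

lemma coeff_halfPoly (σ : ℕ →₀ k) (ℓ : ℕ) : (halfPoly k σ).coeff ℓ = 2⁻¹ * σ ℓ := by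
  simp only [halfPoly_apply, Finsupp.sum, finsetSum_coeff, coeff_C_mul_X_pow]
  simp +contextual

lemma halfPoly_bijective (h2 : (2 : k) ≠ 0) : Function.Bijective (halfPoly k) := by
  refine ⟨fun σ τ h => Finsupp.ext fun ℓ => ?_, fun p =>
    ⟨(2 : k) • Finsupp.onFinset p.support p.coeff fun _ => mem_support_iff.2, ?_⟩⟩
  · have coeff_eq := congrArg (coeff · ℓ) h
    simp only [coeff_halfPoly] at coeff_eq
    exact mul_left_cancel₀ (inv_ne_zero h2) coeff_eq
  · ext ℓ
    rw [coeff_halfPoly, Finsupp.smul_apply, smul_eq_mul, inv_mul_cancel_left₀ h2,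
      Finsupp.onFinset_apply]

lemma halfSum_eq (σ : ℕ →₀ k) (e : ℕ) : halfSum σ e = halfPoly k σ * X ^ e := by
  rw [halfPoly_apply, halfSum, Finsupp.sum_mul]
  simp only [pow_add, mul_assoc, mul_comm (X ^ e)]

lemma halfSumPred_succ (σ : ℕ →₀ k) (e : ℕ) : halfSumPred σ (e + 1) = halfPoly k σ * X ^ e := by
  rw [← halfSum_eq, halfSumPred, halfSum]
  simp only [add_right_comm e 1, Nat.add_sub_cancel]

lemma smul_divX_halfPoly_mul (σ : ℕ →₀ k) {c : k} {e : ℕ} (h : e = 0 → c = 0) :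
    c • divX (halfPoly k σ * X ^ e) = c • halfSumPred σ e := by
  obtain _ | e := e
  · rw [h rfl, zero_smul, zero_smul]
  · rw [halfSumPred_succ, pow_succ', mul_left_comm, divX_X_mul]

lemma divX_halfPoly_mul_qgrade (σ : ℕ →₀ k) (j l : Fin (n + 1)) (e : ℕ) :
    divX (halfPoly k σ * qgrade j l (X ^ e)) =
      (qdeg l j e : k) • divX (halfPoly k σ * X ^ e) := by
  rw [qgrade_X_pow, mul_smul_comm, divX_smul]

lemma mul_X_pow (j m l : Fin (n + 1)) (β α : ℕ) :
    mul j m l (X ^ β) (X ^ α : k[X]) = X ^ (β + α + overlap j m l) := by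
  rw [mul, ← pow_add, ← pow_add, add_comm]

lemma qdeg_self (j : Fin (n + 1)) (e : ℕ) : qdeg j j e = 2 * e := by
  rw [qdeg, gap, sub_self, Int.natAbs_zero, add_zero]

variable (i : Fin (n + 1)) (σ : ℕ →₀ k)

theorem etaOne_halfPoly (j l : Fin (n + 1)) (α : ℕ) :
    etaOne i (halfPoly k σ) j l (X ^ α) = eta1 i σ j l α := by
  have value : halfPoly k σ * qgrade j l (X ^ α) = (qdeg l j α : k) • halfSum σ α := by
    rw [qgrade_X_pow, mul_smul_comm, halfSum_eq]
  rw [etaOne_apply, eta1]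
  obtain rfl | hl := eq_or_ne l i
  · rw [if_neg (not_not.2 rfl)]
    obtain hj | rfl | hj := lt_trichotomy j l
    · rw [augLift_of_lt l hj, if_pos hj, value]
    · have vanish : α = 0 → (qdeg j j α : k) = 0 := by
        rintro rfl; rw [qdeg_self, mul_zero, Nat.cast_zero]
      rw [augLift_self, if_neg (lt_irrefl j), if_neg (lt_irrefl j), divX_halfPoly_mul_qgrade,
        smul_divX_halfPoly_mul σ vanish, smul_comm]
    · rw [augLift_of_gt l hj, if_neg hj.not_gt, if_pos hj, value]
  · rw [augLift_of_ne i j hl, if_pos hl, value]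

variable (j : Fin (n + 1)) {m : Fin (n + 1)} (β α : ℕ)

lemma coeffQ_of_lt (hm : m < i) : coeffQ k i j m β α =
    (if i < j then 1 else if j = i then 2⁻¹ else 0) * (qdeg i j (β + α + overlap j m i) : k) := by
  have sign : sgn i m = 1 := Int.sign_eq_one_of_pos (by omega)
  simp [coeffQ, hm, hm.ne, hm.not_gt, sign]

lemma coeffQ_of_gt (hm : i < m) : coeffQ k i j m β α =
    -(if j < i then 1 else if j = i then 2⁻¹ else 0) * (qdeg i j (β + α + overlap j m i) : k) := by
  have sign : sgn i m = -1 := Int.sign_eq_neg_one_of_neg (by omega)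
  simp only [coeffQ, hm, hm.ne', hm.not_gt, sign, false_and, false_or, and_true, if_false]
  split_ifs <;> simp

lemma coeffQ_mid : coeffQ k i j i β α = sgn j i * 2⁻¹ * (qdeg i i β : k) := by
  simp [coeffQ]

lemma coeffQ_eq_zero (exponent : β + α + overlap j m i = 0) : coeffQ k i j m β α = 0 := by
  obtain ⟨⟨rfl, rfl⟩, overlap_zero⟩ : (β = 0 ∧ α = 0) ∧ overlap j m i = 0 := by omega
  have qdeg_zero : qdeg i i 0 = 0 := by rw [qdeg_self]
  rw [overlap_eq] at overlap_zero
  obtain hm | rfl | hm := lt_trichotomy m i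
  · rw [coeffQ_of_lt i j 0 0 hm, if_neg (by omega)]
    obtain rfl | hj := eq_or_ne j i
    · rw [exponent, qdeg_zero, Nat.cast_zero, mul_zero]
    · rw [if_neg hj, zero_mul]
  · rw [coeffQ_mid, qdeg_zero, Nat.cast_zero, mul_zero]
  · rw [coeffQ_of_gt i j 0 0 hm, if_neg (by omega)]
    obtain rfl | hj := eq_or_ne j i
    · rw [exponent, qdeg_zero, Nat.cast_zero, mul_zero]
    · rw [if_neg hj, neg_zero, zero_mul]

lemma qdeg_smul_divX_halfPoly_mul :
    (qdeg i i β : k) • (divX (halfPoly k σ * X ^ β) * X ^ α) =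
      (qdeg i i β : k) • halfSumPred σ (β + α) := by
  obtain _ | β := β
  · rw [qdeg_self, mul_zero, Nat.cast_zero, zero_smul, zero_smul]
  · rw [pow_succ', mul_left_comm, divX_X_mul, add_right_comm, halfSumPred_succ, mul_assoc,
      ← pow_add]

variable (h0 : 0 < (i : ℕ)) (h1 : (i : ℕ) < n)

lemma etaTwo_halfPoly_self (h2 : (2 : k) ≠ 0) (m : Fin (n + 1)) :
    etaTwo i h0 h1 (halfPoly k σ) j m i (X ^ β) (X ^ α) =
      entry 0 0 (coeffQ k i j m β α • halfSumPred σ (β + α + overlap j m i)) := by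
  obtain hm | rfl | hm := lt_trichotomy m i
  · rw [etaTwo_of_lt i h0 h1 _ _ _ hm, mul_X_pow, divX_halfPoly_mul_qgrade, smul_smul,
      ← coeffQ_of_lt i j β α hm, smul_divX_halfPoly_mul σ (coeffQ_eq_zero i j β α)]
  · have overlap_zero : overlap j m m = 0 := by rw [overlap_eq]; omega
    rw [etaTwo_mid, divX_halfPoly_mul_qgrade, smul_mul_assoc, qdeg_smul_divX_halfPoly_mul,
      smul_smul, coeffQ_mid, overlap_zero, add_zero]
  · rw [etaTwo_of_gt i h0 h1 _ _ _ h2 hm, mul_X_pow, divX_halfPoly_mul_qgrade, smul_smul,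
      ← coeffQ_of_gt i j β α hm, smul_divX_halfPoly_mul σ (coeffQ_eq_zero i j β α)]

theorem etaTwo_halfPoly (h2 : (2 : k) ≠ 0) (m l : Fin (n + 1)) :
    etaTwo i h0 h1 (halfPoly k σ) j m l (X ^ β) (X ^ α) = eta2 i σ j m l β α := by
  rw [eta2]
  obtain rfl | hl := eq_or_ne l i
  · rw [if_pos rfl, etaTwo_halfPoly_self l σ j β α h0 h1 h2]
  · rw [if_neg hl, etaTwo_apply, retr_of_ne i j hl]

end HalfSums

end KLRW

theorem mainTheorem8 (k : Type*) [Field k] (h2 : (2 : k) ≠ 0) (n : ℕ) (i : Fin (n + 1))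
    (h0 : 0 < (i : ℕ)) (h1 : (i : ℕ) < n) :
    ∃ η : (ℕ →₀ k) →ₗ[k] KLRW.NatTrans (KLRW.incl k n) (KLRW.negBraid k i h0 h1) 1,
      (∀ σ : ℕ →₀ k,
        (∀ x a, (η σ : KLRW.Family k n) 0 x a = 0) ∧
        (∀ (j l : Fin (n + 1)) (α : ℕ),
          (η σ : KLRW.Family k n) 1 ![j, l] ![X ^ α] = KLRW.eta1 i σ j l α) ∧
        (∀ (j m l : Fin (n + 1)) (α β : ℕ),
          (η σ : KLRW.Family k n) 2 ![j, m, l] ![X ^ α, X ^ β] = KLRW.eta2 i σ j m l β α) ∧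
        (∀ d, 3 ≤ d → ∀ x a, (η σ : KLRW.Family k n) d x a = 0)) ∧
      Function.Bijective fun σ =>
        (KLRW.coboundaries (KLRW.incl k n) (KLRW.negBraid k i h0 h1) 1).mkQ (η σ) := by
  refine ⟨KLRW.eta i h0 h1 h2 ∘ₗ KLRW.halfPoly k, fun σ => ⟨fun _ _ => rfl, ?_, ?_, ?_⟩, ?_⟩
  · exact KLRW.etaOne_halfPoly i σ
  · exact fun j m l α β => KLRW.etaTwo_halfPoly i σ j β α h0 h1 h2 m l
  · rintro (_ | _ | _ | d) hd x a
    · omega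
    · omega
    · omega
    · rfl
  · exact (show Function.Bijective _ from ⟨KLRW.mkQ_eta_injective i h0 h1 h2,
      KLRW.mkQ_eta_surjective i h0 h1 h2⟩).comp (KLRW.halfPoly_bijective h2)
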